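/- For integers $k\ge 0$ let $$\gamma_k=\lim_{N\to\infty}\Big(\sum_{m=1}^N\frac{\log^k m}{m}-\frac{\log^{k+1}N}{k+1}\Big)$$ be the Stieltjes constants (with $\log^0 1=1$; these limits exist). For integers $n\ge 1$ and real $t$ put $$\ell_n=(-1)^n\sum_{k=1}^n\binom{n-1}{k-1}\frac{(-1)^k\gamma_k}{k!},\qquad e_n(t)=\Big(\frac{\frac12-it}{\frac12+it}\Big)^n,$$ and let $\mu$ be the probability measure $d\mu(t)=\frac{1}{2\pi}\,\frac{dt}{\frac14+t^2}$ on $\mathbb{R}$. Let $\zeta$ be the Riemann zeta function. Then, for every $t\in\mathbb{R}$, $$\zeta\big(\tfrac12+it\big)=\gamma_0-\frac{1}{\frac12-it}+\sum_{n=1}^{\infty}\ell_n\,e_n(t),$$ where the series converges pointwise as the limit of its partial sums $\sum_{n=1}^N$, $N\to\infty$. Moreover $t\mapsto\zeta(\frac12+it)$ belongs to $L^2(\mu)$, and the partial sums $\gamma_0-\frac{1}{\frac12-it}+\sum_{n=1}^N\ell_n e_n(t)$ converge to it in $L^2(\mu)$. For every $n\ge 1$, $\ell_n$ is the $n$-th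 Fourier coefficient, $$\ell_n=\int_{\mathbb{R}}\zeta\big(\tfrac12+it\big)\,\overline{e_n(t)}\,d\mu(t),$$ and $$\ell_n=-\operatorname{Res}_{s=1}\frac{\zeta(s)\,s^{n-1}}{(1-s)^{n+1}},$$ that is, $-\ell_n=\frac{1}{2\pi i}\oint_{|s-1|=r}\frac{\zeta(s)s^{n-1}}{(1-s)^{n+1}}\,ds$ for every $0<r<1$, the circle being positively oriented. -/

import Mathlib

open MeasureTheory Filter Topology

/-- The `N`-th approximant `∑_{m=1}^N (log m)^k / m - (log N)^(k+1) / (k+1)`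
of the `k`-th Stieltjes constant. -/
noncomputable def stieltjesApprox (k N : ℕ) : ℝ :=
  (∑ m ∈ Finset.Icc 1 N, Real.log m ^ k / m) - Real.log N ^ (k + 1) / (k + 1)

/-- The `k`-th Stieltjes constant `γ_k`, the limit of its approximants. -/
noncomputable def stieltjesConst (k : ℕ) : ℝ :=
  limUnder atTop (stieltjesApprox k)

/-- `ℓ_n = (-1)^n ∑_{k=1}^n C(n-1, k-1) (-1)^k γ_k / k!`, used for `n ≥ 1`. -/
noncomputable def ellCoeff (n : ℕ) : ℝ :=
  (-1) ^ n * ∑ k ∈ Finset.Icc 1 n,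
    ((n - 1).choose (k - 1) : ℝ) * ((-1) ^ k * stieltjesConst k / (k.factorial : ℝ))

/-- `e_n(t) = ((1/2 - it) / (1/2 + it))^n`. -/
noncomputable def eFun (n : ℕ) (t : ℝ) : ℂ :=
  ((1 / 2 - Complex.I * t) / (1 / 2 + Complex.I * t)) ^ n

/-- `t ↦ ζ(1/2 + it)`. -/
noncomputable def zetaLine (t : ℝ) : ℂ :=
  riemannZeta (1 / 2 + Complex.I * t)

/-- The measure `μ` on `ℝ` with density `1 / (2π (1/4 + t²))`. -/
noncomputable def cauchyMu : Measure ℝ :=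
  volume.withDensity fun t => ENNReal.ofReal (1 / (2 * Real.pi) * (1 / (1 / 4 + t ^ 2)))

/-- `γ_0 - 1/(1/2 - it) + ∑_{n=1}^N ℓ_n e_n(t)`. -/
noncomputable def zetaPartial (N : ℕ) (t : ℝ) : ℂ :=
  (stieltjesConst 0 : ℂ) - 1 / (1 / 2 - Complex.I * t)
    + ∑ n ∈ Finset.Icc 1 N, (ellCoeff n : ℂ) * eFun n t

/-!
Write `ζ(s) = 1/(s - 1) + g(s)` with `g = riemannZeta₀` entire. The map `w = (1 - s)/s`, that is
`s = 1/(1 + w)`, carries the half-plane `Re s > 1/2` onto the unit disc, `s = 1` to `w = 0`, and the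
critical line onto the unit circle without the point `-1`. There `w = cayley t`, so that
`e_n(t) = w^n`, and `cauchyMu` is the normalized arc length. The theorem says that the Taylor series
`γ_0 + ∑ ℓ_n w^n` of `G(w) = g(1/(1 + w))` is the Fourier series of its boundary values and converges
to them pointwise away from `w = -1` and in `L²`.

*Coefficients.* The functions `(s - 1) ∑_{m ≤ N} m^{-s} + N^{1-s}` tend locally uniformly to
`(s - 1) ζ(s)` in `Re s > 0`. Comparing derivatives at `s = 1` shows that the Stieltjes limits exist
and that `g` has the Taylor coefficients `(-1)^k γ_k / k!` at `1` (`iteratedDeriv_riemannZeta₀`).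
Cauchy's formula then gives the residue (`circleIntegral_riemannZeta`), and rearranging the Taylor
series gives the power series in `w` (`hasSum_ellCoeff`).

*Boundary values.* For `Re s > 0` one has `g(s) = 1 - s h(s)` with
`h(s) = ∫_1^∞ {x} x^{-s-1} dx`. On the critical line `h` is a Fourier transform of a function in
`L¹ ∩ L²`, so by Plancherel `g` is in `L²(cauchyMu)` (`memLp_riemannZeta₀_line`). The elementary
bound `g(s) = O(|s|^{1/2})` for `Re s ≥ 1/2` allows letting the radius tend to `1` in the integrals
over circles: the Fourier coefficients of the boundary function are the Taylor coefficients for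
`n ≥ 0` and vanish for `n < 0`.

*Convergence.* For a boundary point `w₀ ≠ -1` the quotient `(G(w) - G(w₀))/(w - w₀)` is still in `L²`
of the circle, and the error of the `N`-th partial sum at `w₀` is, up to a factor of absolute value
`1`, its `N`-th Fourier coefficient (`sum_zetaCoeff_sub`), which tends to `0` by Bessel's
inequality. Bessel's inequality for `G` itself makes the coefficients square-summable, and Fatou's
lemma turns pointwise convergence into convergence in `L²`
(`eLpNorm_riemannZeta₀_sub_sum_le`). No completeness of the system `w^n` is needed.
-/

/-! ### The integral representation of `ζ` in the right half-plane -/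

lemma integrableOn_fract_mul_cpow {s : ℂ} (hs : 0 < s.re) {a : ℝ} (ha : 0 < a) :
    IntegrableOn (fun x : ℝ => ((Int.fract x : ℝ) : ℂ) * (x : ℂ) ^ (-(s + 1))) (Set.Ioi a) := by
  refine Integrable.mono (g := fun x : ℝ => (x : ℂ) ^ (-(s + 1)))
    (integrableOn_Ioi_cpow_of_lt (by simpa using hs) ha) ?_ ?_
  · refine AEStronglyMeasurable.mul ?_ ?_
    · exact (Complex.measurable_ofReal.comp measurable_fract).aestronglyMeasurable
    · exact (integrableOn_Ioi_cpow_of_lt (by simpa using hs) ha).aestronglyMeasurable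
  · refine Eventually.of_forall fun x => ?_
    rw [norm_mul, Complex.norm_real, Real.norm_of_nonneg (Int.fract_nonneg x)]
    exact mul_le_of_le_one_left (norm_nonneg _) (Int.fract_lt_one x).le

lemma norm_integral_fract_mul_cpow_le {s : ℂ} (hs : 0 < s.re) {a : ℝ} (ha : 0 < a) :
    ‖∫ x in Set.Ioi a, ((Int.fract x : ℝ) : ℂ) * (x : ℂ) ^ (-(s + 1))‖ ≤ a ^ (-s.re) / s.re := by
  have h1 : -s.re - 1 < -1 := by linarith
  have key : ∫ x in Set.Ioi a, x ^ (-s.re - 1) = a ^ (-s.re) / s.re := by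
    rw [integral_Ioi_rpow_of_lt h1 ha]
    simp [neg_div_neg_eq]
  rw [← key]
  refine norm_integral_le_of_norm_le (integrableOn_Ioi_rpow_of_lt h1 ha) ?_
  filter_upwards [ae_restrict_mem measurableSet_Ioi] with x hx
  have hx0 : 0 < x := ha.trans hx
  rw [norm_mul, Complex.norm_real, Real.norm_of_nonneg (Int.fract_nonneg x),
    Complex.norm_cpow_eq_rpow_re_of_pos hx0]
  have : (-(s + 1)).re = -s.re - 1 := by simp; ring
  rw [this]
  exact mul_le_of_le_one_left (by positivity) (Int.fract_lt_one x).le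

/-- `(s - 1) ∑_{m ≤ N} m^{-s} + N^{1 - s}`, for `N ≥ 1` an entire function of `s` that approximates
`(s - 1) ζ(s)` in the half-plane `Re s > 0`. -/
noncomputable def zetaApprox (N : ℕ) (s : ℂ) : ℂ :=
  (s - 1) * ∑ m ∈ Finset.Icc 1 N, (m : ℂ) ^ (-s) + (N : ℂ) ^ (1 - s)

lemma zetaApprox_one (s : ℂ) : zetaApprox 1 s = s := by simp [zetaApprox]

/-- Integration by parts on `[n, n + 1]`, where `{x} = x - n`. The factor `s - 1` keeps the primitive
`-(s - 1) (x - n) x^{-s} - x^{1 - s}` free of denominators, so that `s = 1` is not exceptional. -/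
lemma zetaApprox_succ_sub {n : ℕ} (hn : 1 ≤ n) (s : ℂ) :
    (s - 1) * s * ∫ x in (n : ℝ)..(n + 1 : ℕ), ((Int.fract x : ℝ) : ℂ) * (x : ℂ) ^ (-(s + 1))
      = zetaApprox n s - zetaApprox (n + 1) s := by
  have hn' : (0 : ℝ) < n := by exact_mod_cast hn
  have hle : (n : ℝ) ≤ (n + 1 : ℕ) := by push_cast; linarith
  have h1 : ∫ x in (n : ℝ)..(n + 1 : ℕ), ((Int.fract x : ℝ) : ℂ) * (x : ℂ) ^ (-(s + 1))
      = ∫ x in (n : ℝ)..(n + 1 : ℕ), ((x : ℂ) - n) * (x : ℂ) ^ (-(s + 1)) := by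
    refine intervalIntegral.integral_congr_Ioo_of_le hle fun x hx => ?_
    have : Int.fract x = x - n := by
      rw [Int.fract_eq_iff]
      refine ⟨by linarith [hx.1], ?_, n, by simp⟩
      have := hx.2
      push_cast at this
      linarith
    simp [this]
  have hpos : ∀ x ∈ Set.uIcc (n : ℝ) (n + 1 : ℕ), 0 < x := by
    intro x hx
    rw [Set.uIcc_of_le hle] at hx
    exact hn'.trans_le hx.1
  have hderiv : ∀ x ∈ Set.uIcc (n : ℝ) (n + 1 : ℕ), HasDerivAt
      (fun x : ℝ => -(s - 1) * (((x : ℂ) - n) * (x : ℂ) ^ (-s)) - (x : ℂ) ^ (1 - s))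
      ((s - 1) * s * (((x : ℂ) - n) * (x : ℂ) ^ (-(s + 1)))) x := by
    intro x hx
    have hx0 := hpos x hx
    have hx0' : (x : ℂ) ≠ 0 := by exact_mod_cast hx0.ne'
    have hsl : (x : ℂ) ∈ Complex.slitPlane := Complex.ofReal_mem_slitPlane.2 hx0
    have a1 := (((hasDerivAt_id (x : ℂ)).sub_const (n : ℂ)).mul
      ((hasDerivAt_id (x : ℂ)).cpow_const (c := -s) hsl)).const_mul (-(s - 1))
    have a2 := (hasDerivAt_id (x : ℂ)).cpow_const (c := 1 - s) hsl
    have a3 := (a1.sub a2).comp_ofReal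
    convert! a3 using 1
    have e1 : (x : ℂ) ^ (-s - 1) = (x : ℂ) ^ (-(s + 1)) := by ring_nf
    have e2 : (x : ℂ) ^ (1 - s - 1) = (x : ℂ) ^ (-s) := by ring_nf
    have e3 : (x : ℂ) ^ (-s) = (x : ℂ) ^ (-(s + 1)) * x := by
      nth_rw 3 [← Complex.cpow_one (x : ℂ)]
      rw [← Complex.cpow_add _ _ hx0']; ring_nf
    simp only [id, e1, e2, e3]
    ring
  have hcont : IntervalIntegrable
      (fun x : ℝ => (s - 1) * s * (((x : ℂ) - n) * (x : ℂ) ^ (-(s + 1)))) volume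
      (n : ℝ) (n + 1 : ℕ) := by
    refine ContinuousOn.intervalIntegrable fun x hx => ContinuousAt.continuousWithinAt ?_
    have hsl : (x : ℂ) ∈ Complex.slitPlane := Complex.ofReal_mem_slitPlane.2 (hpos x hx)
    have : ContinuousAt (fun x : ℝ => (x : ℂ) ^ (-(s + 1))) x :=
      (Complex.continuous_ofReal.continuousAt (x := x)).cpow continuousAt_const hsl
    fun_prop
  rw [h1, ← intervalIntegral.integral_const_mul,
    intervalIntegral.integral_eq_sub_of_hasDerivAt hderiv hcont]
  simp only [zetaApprox, Finset.sum_Icc_succ_top (by omega : 1 ≤ n + 1)]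
  push_cast
  ring

lemma zetaApprox_eq {N : ℕ} (hN : 1 ≤ N) {s : ℂ} (hs : 0 < s.re) :
    zetaApprox N s = s - (s - 1) * s *
      ∫ x in (1 : ℝ)..N, ((Int.fract x : ℝ) : ℂ) * (x : ℂ) ^ (-(s + 1)) := by
  induction N, hN using Nat.le_induction with
  | base => simp [zetaApprox_one]
  | succ n hn ih =>
    have hint : ∀ a b : ℝ, 1 ≤ a → a ≤ b → IntervalIntegrable
        (fun x : ℝ => ((Int.fract x : ℝ) : ℂ) * (x : ℂ) ^ (-(s + 1))) volume a b :=
      fun a b ha hab =>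
      (intervalIntegrable_iff_integrableOn_Ioc_of_le hab).2
        ((integrableOn_fract_mul_cpow hs (by linarith)).mono_set Set.Ioc_subset_Ioi_self)
    have hn' : (1 : ℝ) ≤ n := by exact_mod_cast hn
    rw [← intervalIntegral.integral_add_adjacent_intervals (hint 1 n le_rfl hn')
      (hint n (n + 1 : ℕ) hn' (by push_cast; linarith))]
    linear_combination ih + zetaApprox_succ_sub hn s

/-- The limit of `zetaApprox N s` in `Re s > 0`, as an improper integral; by `zetaLimit_eq` it is
`(s - 1) ζ(s)` with the pole removed. -/
noncomputable def zetaLimit (s : ℂ) : ℂ :=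
  s - (s - 1) * s * ∫ x in Set.Ioi (1 : ℝ), ((Int.fract x : ℝ) : ℂ) * (x : ℂ) ^ (-(s + 1))

lemma zetaApprox_sub_zetaLimit {N : ℕ} (hN : 1 ≤ N) {s : ℂ} (hs : 0 < s.re) :
    zetaApprox N s - zetaLimit s = (s - 1) * s *
      ∫ x in Set.Ioi (N : ℝ), ((Int.fract x : ℝ) : ℂ) * (x : ℂ) ^ (-(s + 1)) := by
  have hN' : (1 : ℝ) ≤ N := by exact_mod_cast hN
  rw [zetaApprox_eq hN hs, zetaLimit, ← intervalIntegral.integral_interval_add_Ioi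
    (b := N) (integrableOn_fract_mul_cpow hs one_pos)
    (integrableOn_fract_mul_cpow hs (by linarith))]
  ring

lemma norm_zetaApprox_sub_zetaLimit_le {N : ℕ} (hN : 1 ≤ N) {s : ℂ} (hs : 0 < s.re) :
    ‖zetaApprox N s - zetaLimit s‖ ≤ ‖s - 1‖ * ‖s‖ * ((N : ℝ) ^ (-s.re) / s.re) := by
  rw [zetaApprox_sub_zetaLimit hN hs, norm_mul, norm_mul]
  gcongr
  exact norm_integral_fract_mul_cpow_le hs (by exact_mod_cast hN)

lemma isOpen_re_pos : IsOpen {s : ℂ | 0 < s.re} := isOpen_lt continuous_const Complex.continuous_re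

lemma tendstoLocallyUniformlyOn_zetaApprox :
    TendstoLocallyUniformlyOn zetaApprox zetaLimit atTop {s : ℂ | 0 < s.re} := by
  rw [tendstoLocallyUniformlyOn_iff_forall_isCompact isOpen_re_pos]
  intro K hK hKc
  rcases K.eq_empty_or_nonempty with rfl | hne
  · exact tendstoUniformlyOn_empty
  obtain ⟨s₀, hs₀, hmin⟩ := hKc.exists_isMinOn hne Complex.continuous_re.continuousOn
  obtain ⟨B, hB⟩ := hKc.isBounded.exists_norm_le
  have hσ : 0 < s₀.re := hK hs₀
  have hlim : Tendsto (fun N : ℕ => (B + 1) * B * ((N : ℝ) ^ (-s₀.re) / s₀.re)) atTop (𝓝 0) := by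
    have := ((tendsto_rpow_neg_atTop hσ).comp tendsto_natCast_atTop_atTop).div_const s₀.re
    simpa using this.const_mul ((B + 1) * B)
  rw [Metric.tendstoUniformlyOn_iff]
  intro ε hε
  filter_upwards [hlim.eventually (gt_mem_nhds hε), eventually_ge_atTop 1] with N hN hN1 s hs
  have hs0 : 0 < s.re := hK hs
  have hσs : s₀.re ≤ s.re := hmin hs
  have hN' : (1 : ℝ) ≤ N := by exact_mod_cast hN1
  rw [dist_comm, dist_eq_norm]
  refine (norm_zetaApprox_sub_zetaLimit_le hN1 hs0).trans_lt (lt_of_le_of_lt ?_ hN)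
  have hBs := hB s hs
  have hB0 : 0 ≤ B := (norm_nonneg _).trans hBs
  have : ‖s - 1‖ ≤ B + 1 := (norm_sub_le _ _).trans (by simpa using hBs)
  gcongr

lemma differentiable_natCast_cpow {m : ℕ} (hm : m ≠ 0) :
    Differentiable ℂ fun s : ℂ => (m : ℂ) ^ s :=
  fun s => differentiableAt_id.const_cpow (Or.inl (by exact_mod_cast hm))

lemma differentiable_zetaApprox {N : ℕ} (hN : 1 ≤ N) : Differentiable ℂ (zetaApprox N) := by
  unfold zetaApprox
  have h1 : Differentiable ℂ fun s : ℂ => (N : ℂ) ^ (1 - s) :=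
    (differentiable_natCast_cpow (by omega)).comp
      (by fun_prop : Differentiable ℂ fun s : ℂ => 1 - s)
  have h2 : Differentiable ℂ fun s : ℂ => ∑ m ∈ Finset.Icc 1 N, (m : ℂ) ^ (-s) := by
    refine Differentiable.fun_sum fun m hm => ?_
    rw [Finset.mem_Icc] at hm
    exact (differentiable_natCast_cpow (by omega)).comp
      (by fun_prop : Differentiable ℂ fun s : ℂ => -s)
  fun_prop

lemma tendsto_zetaApprox_of_one_lt_re {s : ℂ} (hs : 1 < s.re) :
    Tendsto (fun N => zetaApprox N s) atTop (𝓝 (riemannZeta₁ s)) := by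
  have hs1 : s ≠ 1 := by rintro rfl; simp at hs
  have h1 : Tendsto (fun N : ℕ => ∑ m ∈ Finset.Icc 1 N, (m : ℂ) ^ (-s)) atTop
      (𝓝 (riemannZeta s)) := by
    have hsum : Summable fun n : ℕ => 1 / ((n : ℂ) + 1) ^ s := by
      exact_mod_cast (summable_nat_add_iff 1).2 (Complex.summable_one_div_nat_cpow.2 hs)
    have := hsum.hasSum.tendsto_sum_nat
    rw [← zeta_eq_tsum_one_div_nat_add_one_cpow hs] at this
    refine this.congr fun N => ?_
    induction N with
    | zero => simp
    | succ n ih =>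
      rw [Finset.sum_range_succ, ih, Finset.sum_Icc_succ_top (by omega), Complex.cpow_neg]
      simp
  have h2 : Tendsto (fun N : ℕ => (N : ℂ) ^ (1 - s)) atTop (𝓝 0) := by
    rw [tendsto_zero_iff_norm_tendsto_zero]
    have := (tendsto_rpow_neg_atTop (y := s.re - 1) (by linarith)).comp
      (tendsto_natCast_atTop_atTop (R := ℝ))
    refine this.congr' ?_
    filter_upwards [eventually_gt_atTop 0] with N hN
    rw [Complex.norm_natCast_cpow_of_pos hN]
    simp
  have h3 := (h1.const_mul (s - 1)).add h2
  have : riemannZeta₁ s = (s - 1) * riemannZeta s + 0 := by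
    rw [riemannZeta_eq_inv_sub_mul hs1, mul_inv_cancel_left₀ (sub_ne_zero.2 hs1), add_zero]
  rw [this]
  exact h3

/-- Both sides are holomorphic in `Re s > 0` and they agree for `Re s > 1`, where the Dirichlet
series converges. -/
lemma zetaLimit_eq {s : ℂ} (hs : 0 < s.re) : zetaLimit s = riemannZeta₁ s := by
  have hd : DifferentiableOn ℂ zetaLimit {s : ℂ | 0 < s.re} :=
    tendstoLocallyUniformlyOn_zetaApprox.differentiableOn
      (by filter_upwards [eventually_ge_atTop 1] with N hN
            using (differentiable_zetaApprox hN).differentiableOn) isOpen_re_pos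
  have hev : zetaLimit =ᶠ[𝓝 2] riemannZeta₁ := by
    filter_upwards [(isOpen_lt continuous_const Complex.continuous_re).mem_nhds
      (show (2 : ℂ) ∈ {s : ℂ | 1 < s.re} by simp)] with z hz
    have hz' : 1 < z.re := hz
    exact tendsto_nhds_unique (tendstoLocallyUniformlyOn_zetaApprox.tendsto_at
      (show z ∈ {s : ℂ | 0 < s.re} from by simp only [Set.mem_ofPred_eq]; linarith))
      (tendsto_zetaApprox_of_one_lt_re hz')
  exact (hd.analyticOnNhd isOpen_re_pos).eqOn_of_preconnected_of_eventuallyEq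
    (differentiable_riemannZeta₁.differentiableOn.analyticOnNhd isOpen_re_pos)
    (convex_halfSpace_re_gt 0).isPreconnected (by simp) hev hs

/-- `ζ(s) - 1/(s-1) = 1 - s ∫_1^∞ {x} x^{-s-1} dx` for `Re s > 0`. -/
lemma riemannZeta₀_eq_one_sub {s : ℂ} (hs : 0 < s.re) (hs1 : s ≠ 1) :
    riemannZeta₀ s =
      1 - s * ∫ x in Set.Ioi (1 : ℝ), ((Int.fract x : ℝ) : ℂ) * (x : ℂ) ^ (-(s + 1)) := by
  have h := zetaLimit_eq hs
  rw [zetaLimit, riemannZeta₁] at h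
  refine mul_left_cancel₀ (sub_ne_zero.2 hs1) ?_
  linear_combination -h

/-! ### Stieltjes constants and the residue formula -/

lemma sum_Icc_one_eq_sum_range {M : Type*} [AddCommMonoid M] (f : ℕ → M) (n : ℕ) :
    ∑ k ∈ Finset.Icc 1 n, f k = ∑ j ∈ Finset.range n, f (j + 1) := by
  induction n with
  | zero => simp
  | succ n ih => rw [Finset.sum_Icc_succ_top (by omega), ih, Finset.sum_range_succ]

lemma Differentiable.differentiable_iteratedDeriv_complex {f : ℂ → ℂ} (hf : Differentiable ℂ f)
    (k : ℕ) : Differentiable ℂ (iteratedDeriv k f) :=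
  (hf.contDiff (n := ⊤)).differentiable_iteratedDeriv k (by exact_mod_cast WithTop.coe_lt_top _)

lemma iteratedDeriv_succ_sub_one_mul {f : ℂ → ℂ} (hf : Differentiable ℂ f) (k : ℕ) :
    iteratedDeriv (k + 1) (fun s => (s - 1) * f s) =
      fun s => (s - 1) * iteratedDeriv (k + 1) f s + (k + 1) * iteratedDeriv k f s := by
  have hd : ∀ (j : ℕ) (s : ℂ), HasDerivAt (iteratedDeriv j f) (iteratedDeriv (j + 1) f s) s :=
    fun j s => by
      rw [iteratedDeriv_succ]
      exact (hf.differentiable_iteratedDeriv_complex j s).hasDerivAt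
  induction k with
  | zero =>
    funext s
    rw [iteratedDeriv_one]
    have h := ((hasDerivAt_id s).sub_const 1).mul (hd 0 s)
    simp only [iteratedDeriv_zero] at h
    refine h.deriv.trans ?_
    simp
    ring
  | succ k ih =>
    rw [iteratedDeriv_succ, ih]
    funext s
    have h := (((hasDerivAt_id s).sub_const 1).mul (hd (k + 1) s)).add
      ((hd k s).const_mul ((k : ℂ) + 1))
    refine h.deriv.trans ?_
    simp
    ring

lemma iteratedDeriv_natCast_cpow_sub {m : ℕ} (hm : m ≠ 0) (a : ℂ) (k : ℕ) :
    iteratedDeriv k (fun s : ℂ => (m : ℂ) ^ (a - s)) =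
      fun s => (-(Real.log m : ℂ)) ^ k * (m : ℂ) ^ (a - s) := by
  induction k with
  | zero => simp
  | succ k ih =>
    rw [iteratedDeriv_succ, ih]
    funext s
    have h1 := ((hasDerivAt_id s).const_sub a).const_cpow (c := (m : ℂ))
      (Or.inl (by exact_mod_cast hm))
    refine (h1.const_mul _).deriv.trans ?_
    simp only [id, Complex.natCast_log]
    ring

/-- The Stieltjes approximants are, up to normalization, the Taylor coefficients of `zetaApprox N` at
the point `1`. -/
lemma iteratedDeriv_zetaApprox {N : ℕ} (hN : 1 ≤ N) (k : ℕ) :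
    iteratedDeriv (k + 1) (zetaApprox N) 1 = (k + 1) * (-1) ^ k * (stieltjesApprox k N : ℂ) := by
  have hpow : ∀ m ∈ Finset.Icc 1 N, Differentiable ℂ fun s : ℂ => (m : ℂ) ^ (0 - s) := by
    intro m hm
    rw [Finset.mem_Icc] at hm
    exact (differentiable_natCast_cpow (by omega)).comp
      (by fun_prop : Differentiable ℂ fun s : ℂ => 0 - s)
  have hpowN : Differentiable ℂ fun s : ℂ => (N : ℂ) ^ (1 - s) :=
    (differentiable_natCast_cpow (by omega)).comp
      (by fun_prop : Differentiable ℂ fun s : ℂ => 1 - s)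
  have hsum : Differentiable ℂ fun s : ℂ => ∑ m ∈ Finset.Icc 1 N, (m : ℂ) ^ (0 - s) :=
    Differentiable.fun_sum hpow
  have hprod : Differentiable ℂ fun s : ℂ => (s - 1) * ∑ m ∈ Finset.Icc 1 N, (m : ℂ) ^ (0 - s) := by
    fun_prop
  have e : zetaApprox N = fun s => (s - 1) * ∑ m ∈ Finset.Icc 1 N, (m : ℂ) ^ (0 - s)
      + (N : ℂ) ^ (1 - s) := by
    funext s; simp [zetaApprox]
  rw [e, iteratedDeriv_fun_add (hprod.contDiff.contDiffAt) (hpowN.contDiff.contDiffAt),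
    iteratedDeriv_succ_sub_one_mul hsum, iteratedDeriv_natCast_cpow_sub (by omega)]
  beta_reduce
  rw [sub_self, zero_mul, zero_add, iteratedDeriv_fun_sum fun m hm =>
    (hpow m hm).contDiff.contDiffAt]
  have hk : (k : ℂ) + 1 ≠ 0 := by exact_mod_cast k.succ_ne_zero
  have : ∑ m ∈ Finset.Icc 1 N, iteratedDeriv k (fun s : ℂ => (m : ℂ) ^ (0 - s)) 1
      = (-1) ^ k * ∑ m ∈ Finset.Icc 1 N, (Real.log m : ℂ) ^ k / m := by
    rw [Finset.mul_sum]
    refine Finset.sum_congr rfl fun m hm => ?_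
    rw [Finset.mem_Icc] at hm
    rw [iteratedDeriv_natCast_cpow_sub (by omega)]
    simp only [zero_sub, Complex.cpow_neg_one, neg_pow (Real.log m : ℂ) k]
    ring
  rw [this]
  simp only [stieltjesApprox, Complex.cpow_zero]
  push_cast
  rw [neg_pow (Complex.log N), pow_succ (-1 : ℂ)]
  field_simp
  ring

lemma TendstoLocallyUniformlyOn.iteratedDeriv_of_differentiable {F : ℕ → ℂ → ℂ} {f : ℂ → ℂ}
    {U : Set ℂ} (hU : IsOpen U) (h : TendstoLocallyUniformlyOn F f atTop U)
    (hF : ∀ᶠ n in atTop, Differentiable ℂ (F n)) (k : ℕ) :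
    TendstoLocallyUniformlyOn (fun n => iteratedDeriv k (F n)) (iteratedDeriv k f) atTop U := by
  induction k with
  | zero => simpa using h
  | succ k ih =>
    simp only [iteratedDeriv_succ]
    exact ih.deriv (hF.mono fun n hn =>
      (hn.differentiable_iteratedDeriv_complex k).differentiableOn) hU

lemma iteratedDeriv_succ_riemannZeta₁ (k : ℕ) :
    iteratedDeriv (k + 1) riemannZeta₁ 1 = (k + 1) * iteratedDeriv k riemannZeta₀ 1 := by
  have : riemannZeta₁ = fun s => 1 + (s - 1) * riemannZeta₀ s := by
    funext s; rw [riemannZeta₁]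
  rw [this, iteratedDeriv_const_add (by omega),
    iteratedDeriv_succ_sub_one_mul differentiable_riemannZeta₀]
  simp

lemma tendsto_stieltjesApprox_complex (k : ℕ) :
    Tendsto (fun N => (stieltjesApprox k N : ℂ)) atTop
      (𝓝 ((-1) ^ k * iteratedDeriv k riemannZeta₀ 1)) := by
  have hU := isOpen_re_pos
  have h := tendstoLocallyUniformlyOn_zetaApprox.congr_right fun s hs => zetaLimit_eq hs
  have h1 := (h.iteratedDeriv_of_differentiable hU
    (by filter_upwards [eventually_ge_atTop 1] with N hN using differentiable_zetaApprox hN)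
    (k + 1)).tendsto_at (show (1 : ℂ) ∈ {s : ℂ | 0 < s.re} by simp)
  rw [iteratedDeriv_succ_riemannZeta₁] at h1
  have hk : (k : ℂ) + 1 ≠ 0 := by exact_mod_cast k.succ_ne_zero
  have h3 := h1.const_mul ((-1) ^ k * ((k : ℂ) + 1)⁻¹)
  rw [mul_assoc, inv_mul_cancel_left₀ hk] at h3
  refine h3.congr' ?_
  filter_upwards [eventually_ge_atTop 1] with N hN
  rw [iteratedDeriv_zetaApprox hN]
  have : ((-1 : ℂ) ^ k) * (-1) ^ k = 1 := by rw [← mul_pow]; simp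
  field_simp
  linear_combination (stieltjesApprox k N : ℂ) * this

lemma tendsto_stieltjesApprox (k : ℕ) :
    Tendsto (stieltjesApprox k) atTop (𝓝 (stieltjesConst k)) := by
  have h := (Complex.continuous_re.tendsto _).comp (tendsto_stieltjesApprox_complex k)
  exact tendsto_nhds_limUnder ⟨_, h⟩

/-- The Laurent expansion `ζ(s) = 1/(s - 1) + ∑ (-1)^k γ_k (s - 1)^k / k!`, in terms of derivatives. -/
lemma iteratedDeriv_riemannZeta₀ (k : ℕ) :
    iteratedDeriv k riemannZeta₀ 1 = (-1) ^ k * (stieltjesConst k : ℂ) := by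
  have h := tendsto_nhds_unique
    ((Complex.continuous_ofReal.tendsto _).comp (tendsto_stieltjesApprox k))
    (tendsto_stieltjesApprox_complex k)
  rw [h, ← mul_assoc, ← mul_pow]
  simp

/-- The residue formula. Since `ζ(s) = riemannZeta₁ s / (s - 1)`, expanding `s^{n-1}` in powers of
`s - 1` reduces it to Cauchy's formula for the derivatives of the entire function `riemannZeta₁`. -/
lemma circleIntegral_riemannZeta {n : ℕ} (hn : 1 ≤ n) {r : ℝ} (hr : 0 < r) :
    (2 * Real.pi * Complex.I)⁻¹ *
        (∮ s in C(1, r), riemannZeta s * s ^ (n - 1) / (1 - s) ^ (n + 1))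
      = -(ellCoeff n : ℂ) := by
  obtain ⟨m, rfl⟩ : ∃ m, n = m + 1 := ⟨n - 1, by omega⟩
  have hcong : ∀ s ∈ Metric.sphere (1 : ℂ) r,
      riemannZeta s * s ^ (m + 1 - 1) / (1 - s) ^ (m + 1 + 1) =
        ∑ j ∈ Finset.range (m + 1), ((-1) ^ m * (m.choose j : ℂ)) *
          ((1 / (s - 1) ^ (j + 2 + 1)) • riemannZeta₁ s) := by
    intro s hs
    have hs1 : s - 1 ≠ 0 := by
      intro h
      rw [mem_sphere_iff_norm, h, norm_zero] at hs
      exact hr.ne hs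
    have hpow : s ^ m = ∑ j ∈ Finset.range (m + 1), (m.choose j : ℂ) * (s - 1) ^ (m - j) := by
      conv_lhs => rw [show s = 1 + (s - 1) by ring, add_pow]
      exact Finset.sum_congr rfl fun j _ => by simp [mul_comm]
    rw [riemannZeta_eq_inv_sub_mul (sub_ne_zero.1 hs1), Nat.add_sub_cancel, hpow, Finset.mul_sum,
      Finset.sum_div]
    refine Finset.sum_congr rfl fun j hj => ?_
    have hj : j ≤ m := Nat.lt_succ_iff.1 (Finset.mem_range.1 hj)
    obtain ⟨i, rfl⟩ := Nat.exists_eq_add_of_le hj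
    have e : (1 - s) ^ (j + i + 1 + 1) = (-1) ^ (j + i) * (s - 1) ^ (j + i + 1 + 1) := by
      rw [← neg_sub s 1, neg_pow (s - 1)]; ring
    have hsq : ((-1 : ℂ) ^ (j + i)) * (-1) ^ (j + i) = 1 := by rw [← mul_pow]; simp
    rw [e, Nat.add_sub_cancel_left, smul_eq_mul]
    have hne : ((-1 : ℂ) ^ (j + i)) ≠ 0 := by simp
    field_simp
    linear_combination
      (-(riemannZeta₁ s * ((j + i).choose j : ℂ) * (s - 1) ^ (i + j + 3))) * hsq
  rw [circleIntegral.integral_congr hr.le hcong, circleIntegral.integral_fun_sum]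
  · simp only [circleIntegral.integral_const_mul]
    have hC : ∀ j : ℕ, (∮ s in C(1, r), (1 / (s - 1) ^ (j + 2 + 1)) • riemannZeta₁ s)
        = (2 * Real.pi * Complex.I) * ((-1) ^ (j + 1) * (stieltjesConst (j + 1) : ℂ)
          / ((j + 1).factorial : ℂ)) := by
      intro j
      rw [differentiable_riemannZeta₁.differentiableOn.circleIntegral_one_div_sub_center_pow_smul
        hr, iteratedDeriv_succ_riemannZeta₁, iteratedDeriv_riemannZeta₀, Nat.factorial_succ (j + 1),
        smul_eq_mul]
      have h1 : ((j + 1).factorial : ℂ) ≠ 0 := by exact_mod_cast (j + 1).factorial_ne_zero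
      have h2 : (((j + 1 : ℕ) : ℂ) + 1) ≠ 0 := by exact_mod_cast (j + 1).succ_ne_zero
      push_cast at h2 ⊢
      field_simp
    simp only [hC, ellCoeff]
    rw [sum_Icc_one_eq_sum_range, Nat.add_sub_cancel]
    push_cast
    rw [Finset.mul_sum, Finset.mul_sum, ← Finset.sum_neg_distrib]
    refine Finset.sum_congr rfl fun j _ => ?_
    have hpi : (Real.pi : ℂ) ≠ 0 := by exact_mod_cast Real.pi_ne_zero
    have hI := Complex.I_ne_zero
    field_simp
    ring
  · intro j hj
    refine ContinuousOn.circleIntegrable hr.le fun s hs => ContinuousAt.continuousWithinAt ?_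
    have hs1 : s - 1 ≠ 0 := by
      intro h
      rw [mem_sphere_iff_norm, h, norm_zero] at hs
      exact hr.ne hs
    have := (differentiable_riemannZeta₁ s).continuousAt
    have hp : (s - 1) ^ (j + 2 + 1) ≠ 0 := pow_ne_zero _ hs1
    fun_prop (disch := assumption)

/-! ### Growth on the half-plane `Re s ≥ 1/2` and the power series in the disc -/

lemma sum_Icc_inv_sqrt_le (N : ℕ) :
    ∑ m ∈ Finset.Icc 1 N, 1 / √(m : ℝ) ≤ 2 * √(N : ℝ) := by
  induction N with
  | zero => simp
  | succ n ih =>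
    rw [Finset.sum_Icc_succ_top (by omega)]
    have h0 : 0 < √((n + 1 : ℕ) : ℝ) := Real.sqrt_pos.2 (by positivity)
    have h1 : √((n + 1 : ℕ) : ℝ) ^ 2 = n + 1 := by rw [Real.sq_sqrt (by positivity)]; simp
    have h2 : √(n : ℝ) ^ 2 = n := Real.sq_sqrt (by positivity)
    have : 1 / √((n + 1 : ℕ) : ℝ) ≤ 2 * √((n + 1 : ℕ) : ℝ) - 2 * √(n : ℝ) := by
      rw [div_le_iff₀ h0]
      nlinarith [sq_nonneg (√((n + 1 : ℕ) : ℝ) - √(n : ℝ))]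
    linarith

/-- The trivial bound `O(|s|^{1/2})`: the approximation by `zetaApprox N` is used with `N` about
`|s|`, which balances the partial sum `O(√N)` against the error `O(|s| / √N)`. -/
lemma norm_riemannZeta₀_le_of_one_le {s : ℂ} (hs : 1 / 2 ≤ s.re) (h1 : 1 ≤ ‖s - 1‖) :
    ‖riemannZeta₀ s‖ ≤ 12 * √‖s‖ := by
  have hs0 : 0 < s.re := by linarith
  have hns : 1 / 2 ≤ ‖s‖ := hs.trans (Complex.re_le_norm s)
  set N := ⌈‖s‖⌉₊ with hNdef
  have hN : 1 ≤ N := Nat.one_le_ceil_iff.2 (by linarith)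
  have hNr : (1 : ℝ) ≤ N := by exact_mod_cast hN
  have hsN : ‖s‖ ≤ N := Nat.le_ceil _
  have hNs : (N : ℝ) ≤ 4 * ‖s‖ := by
    have := Nat.ceil_lt_add_one (norm_nonneg s)
    rw [← hNdef] at this
    linarith
  have hsq1 : 1 ≤ √(N : ℝ) := Real.one_le_sqrt.2 hNr
  have hsq2 : √(N : ℝ) ≤ 2 * √‖s‖ := by
    rw [show (2 : ℝ) = √4 by rw [show (4 : ℝ) = 2 ^ 2 by norm_num]; simp,
      ← Real.sqrt_mul (by norm_num)]
    exact Real.sqrt_le_sqrt hNs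
  have hpow : ∀ m : ℕ, 1 ≤ m → (m : ℝ) ^ (-s.re) ≤ 1 / √(m : ℝ) := by
    intro m hm
    have hm' : (1 : ℝ) ≤ m := by exact_mod_cast hm
    rw [Real.sqrt_eq_rpow, one_div, ← Real.rpow_neg (by positivity)]
    exact Real.rpow_le_rpow_of_exponent_le hm' (by linarith)
  have hsum : ‖∑ m ∈ Finset.Icc 1 N, (m : ℂ) ^ (-s)‖ ≤ 2 * √(N : ℝ) := by
    refine (norm_sum_le_of_le _ fun m hm => ?_).trans (sum_Icc_inv_sqrt_le N)
    rw [Finset.mem_Icc] at hm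
    rw [Complex.norm_natCast_cpow_of_pos (by omega)]
    simpa using hpow m hm.1
  have hlast : ‖(N : ℂ) ^ (1 - s)‖ ≤ √(N : ℝ) := by
    rw [Complex.norm_natCast_cpow_of_pos (by omega), Real.sqrt_eq_rpow]
    exact Real.rpow_le_rpow_of_exponent_le hNr (by simp; linarith)
  have herr : (N : ℝ) ^ (-s.re) / s.re ≤ 2 / √(N : ℝ) := by
    rw [div_le_div_iff₀ hs0 (by positivity)]
    have := hpow N hN
    rw [le_div_iff₀ (by positivity)] at this
    linarith
  have hsN' : ‖s‖ * (2 / √(N : ℝ)) ≤ 2 * √(N : ℝ) := by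
    rw [mul_div_assoc', div_le_iff₀ (by positivity)]
    nlinarith [Real.sq_sqrt (show (0 : ℝ) ≤ N by positivity)]
  have key : (s - 1) * riemannZeta₀ s = (s - 1) * ∑ m ∈ Finset.Icc 1 N, (m : ℂ) ^ (-s)
      + (N : ℂ) ^ (1 - s) - 1 - (zetaApprox N s - zetaLimit s) := by
    rw [zetaLimit_eq hs0, riemannZeta₁, zetaApprox]
    ring
  have hb : ‖s - 1‖ * ‖riemannZeta₀ s‖ ≤ ‖s - 1‖ * (12 * √‖s‖) := by
    rw [← norm_mul, key]
    calc _ ≤ ‖s - 1‖ * (2 * √(N : ℝ)) + √(N : ℝ) + 1 + ‖s - 1‖ * ‖s‖ * (2 / √(N : ℝ)) := by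
          refine (norm_sub_le _ _).trans (add_le_add ((norm_sub_le _ _).trans (add_le_add
            ((norm_add_le _ _).trans (add_le_add ?_ hlast)) (by simp))) ?_)
          · rw [norm_mul]; gcongr
          · exact (norm_zetaApprox_sub_zetaLimit_le hN hs0).trans (by gcongr)
      _ ≤ ‖s - 1‖ * (6 * √(N : ℝ)) := by nlinarith [norm_nonneg (s - 1)]
      _ ≤ ‖s - 1‖ * (12 * √‖s‖) := by
          exact mul_le_mul_of_nonneg_left (by linarith) (norm_nonneg _)
  exact le_of_mul_le_mul_left hb (by linarith)

lemma exists_norm_riemannZeta₀_le :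
    ∃ C : ℝ, 0 ≤ C ∧ ∀ s : ℂ, 1 / 2 ≤ s.re → ‖riemannZeta₀ s‖ ≤ C * √‖s‖ := by
  obtain ⟨B, hB⟩ := (isCompact_closedBall (1 : ℂ) 1).exists_bound_of_continuousOn
    differentiable_riemannZeta₀.continuous.continuousOn
  have hB0 : 0 ≤ B := (norm_nonneg _).trans (hB 1 (by simp))
  refine ⟨12 + 2 * B, by linarith, fun s hs => ?_⟩
  rcases le_total 1 ‖s - 1‖ with h | h
  · refine (norm_riemannZeta₀_le_of_one_le hs h).trans ?_
    gcongr
    linarith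
  · have h1 := hB s (by simpa [dist_eq_norm] using h)
    have hns : 1 / 2 ≤ ‖s‖ := hs.trans (Complex.re_le_norm s)
    have h2 : 1 / 2 ≤ √‖s‖ := Real.le_sqrt_of_sq_le (by linarith)
    nlinarith

open Finset in
/-- The power series of `riemannZeta₀ s` in the variable `w` with `s = 1 / (1 + w)`. It arises from
the Taylor series at `s = 1` by expanding `(s - 1)^k = (-w)^k (1 + w)^{-k}` and rearranging the
absolutely convergent double series. -/
lemma hasSum_ellCoeff {w : ℂ} (hw : ‖w‖ < 1) :
    HasSum (fun n => (ellCoeff n : ℂ) * w ^ n) (riemannZeta₀ (1 + w)⁻¹ - stieltjesConst 0) := by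
  set a : ℕ → ℂ := fun k => (-1) ^ k * (stieltjesConst k : ℂ) / (k.factorial : ℂ) with ha
  have taylor : ∀ z : ℂ, HasSum (fun k => a k * (z - 1) ^ k) (riemannZeta₀ z) := by
    intro z
    convert! Complex.hasSum_taylorSeries_of_entire differentiable_riemannZeta₀ 1 z using 1
    funext k
    simp only [ha, iteratedDeriv_riemannZeta₀, smul_eq_mul]
    ring
  have hw1 : 1 + w ≠ 0 := by
    intro h
    rw [← neg_eq_of_add_eq_zero_right h] at hw
    simp at hw
  have hw' : 0 < 1 - ‖w‖ := by linarith
  set F : ℕ × ℕ → ℂ := fun p => a (p.1 + 1) * (-w) ^ (p.1 + 1) *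
    (((p.2 + p.1).choose p.1 : ℂ) * (-w) ^ p.2) with hF
  have hfib : ∀ k, HasSum (fun j => F (k, j)) (a (k + 1) * ((1 + w)⁻¹ - 1) ^ (k + 1)) := by
    intro k
    have h := (hasSum_choose_mul_geometric_of_norm_lt_one k (r := -w) (by simpa using hw)).mul_left
      (a (k + 1) * (-w) ^ (k + 1))
    convert! h using 1
    rw [show (1 + w)⁻¹ - 1 = -w * (1 - -w)⁻¹ by rw [sub_neg_eq_add]; field_simp; ring, mul_pow]
    simp [mul_assoc]
  -- The sums of absolute values are the terms of the Taylor series at `1 + ‖w‖ / (1 - ‖w‖)`.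
  have hfibn : ∀ k, HasSum (fun j => ‖F (k, j)‖)
      (‖a (k + 1) * (((1 + ‖w‖ / (1 - ‖w‖) : ℝ) : ℂ) - 1) ^ (k + 1)‖) := by
    intro k
    have h := (hasSum_choose_mul_geometric_of_norm_lt_one k (r := ‖w‖) (by simpa using hw)).mul_left
      (‖a (k + 1)‖ * ‖w‖ ^ (k + 1))
    convert! h using 1
    · funext j
      simp [hF]
    · rw [← Complex.ofReal_one, ← Complex.ofReal_sub, add_sub_cancel_left, norm_mul, norm_pow,
        Complex.norm_real, Real.norm_of_nonneg (by positivity), div_pow]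
      ring
  have hsumm : Summable F := by
    refine Summable.of_norm ((summable_prod_of_nonneg fun p => norm_nonneg _).2
      ⟨fun k => (hfibn k).summable, ?_⟩)
    simp only [(hfibn _).tsum_eq]
    exact (summable_nat_add_iff (f := fun k => ‖a k * (((1 + ‖w‖ / (1 - ‖w‖) : ℝ) : ℂ) - 1) ^ k‖)
      1).2 (taylor _).summable.norm
  have htot : ∑' p, F p = riemannZeta₀ (1 + w)⁻¹ - stieltjesConst 0 := by
    refine (hsumm.hasSum.prod_fiberwise hfib).unique ?_
    have := (hasSum_nat_add_iff' 1).2 (taylor (1 + w)⁻¹)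
    simpa [ha] using this
  have hS : HasSum F (riemannZeta₀ (1 + w)⁻¹ - stieltjesConst 0) := htot ▸ hsumm.hasSum
  have hanti := ((Equiv.hasSum_iff (f := F) HasAntidiagonal.sigmaAntidiagonalEquivProd).2
    hS).sigma fun n => hasSum_fintype _
  have hell0 : ellCoeff 0 = 0 := by simp [ellCoeff]
  rw [← hasSum_nat_add_iff' 1]
  convert! hanti using 1
  · funext n
    simp only [Function.comp, HasAntidiagonal.sigmaAntidiagonalEquivProd_apply]
    rw [univ_eq_attach, sum_attach (antidiagonal n) F, Nat.sum_antidiagonal_eq_sum_range_succ_mk,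
      ellCoeff, sum_Icc_one_eq_sum_range]
    push_cast
    rw [mul_sum, sum_mul]
    refine sum_congr rfl fun k hk => ?_
    have hk : k ≤ n := Nat.lt_succ_iff.1 (mem_range.1 hk)
    obtain ⟨i, rfl⟩ := Nat.exists_eq_add_of_le hk
    simp only [hF, ha, Nat.add_sub_cancel_left, add_comm i k, neg_pow w]
    ring
  · simp [hell0]

/-! ### Square-integrability of Fourier integrals -/

open scoped FourierTransform SchwartzMap ContDiff in
/-- The `L²` half of Plancherel's theorem for the pointwise Fourier integral: it maps `L¹ ∩ L²` into
`L²`. The Fourier integral and the `L²` Fourier transform agree as tempered distributions, hence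
almost everywhere. -/
lemma memLp_fourier_of_integrable_of_memLp {f : ℝ → ℂ} (hf1 : Integrable f) (hf2 : MemLp f 2) :
    MemLp (𝓕 f) 2 := by
  set F : Lp ℂ 2 (volume : Measure ℝ) := 𝓕 (hf2.toLp f)
  have hcont : Continuous (𝓕 f) :=
    VectorFourier.fourierIntegral_continuous Real.continuous_fourierChar
      (by exact continuous_inner) hf1
  have hae : ∀ᵐ x, F x = 𝓕 f x := by
    refine ae_eq_of_integral_contDiff_smul_eq
      ((Lp.memLp F).locallyIntegrable (by norm_num)) hcont.locallyIntegrable fun g hg hgs => ?_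
    have hgc : ContDiff ℝ ∞ fun x => (g x : ℂ) := Complex.ofRealCLM.contDiff.comp hg
    have hgcs : HasCompactSupport fun x => (g x : ℂ) := hgs.comp_left Complex.ofReal_zero
    set ψ : 𝓢(ℝ, ℂ) := hgcs.toSchwartzMap hgc
    have h1 : ∫ x, ψ x • F x = ∫ x, (𝓕 ψ) x • f x := by
      rw [← Lp.toTemperedDistribution_apply (μ := volume) F ψ,
        ← Lp.fourier_toTemperedDistribution_eq, TemperedDistribution.fourier_apply,
        Lp.toTemperedDistribution_apply]
      refine integral_congr_ae ?_
      filter_upwards [hf2.coeFn_toLp] with x hx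
      rw [hx]
    have h2 : ∫ x, 𝓕 f x • ψ x = ∫ x, f x • (𝓕 ψ) x := by
      have := VectorFourier.integral_fourierIntegral_smul_eq_flip (μ := volume) (ν := volume)
        (L := innerₗ ℝ) (f := f) (g := ψ) Real.continuous_fourierChar continuous_inner hf1
        ψ.integrable
      simpa [SchwartzMap.fourier_coe, flip_innerₗ] using! this
    have e1 : ∫ x, g x • F x = ∫ x, ψ x • F x := by
      refine integral_congr_ae (Eventually.of_forall fun x => ?_)
      simp [ψ]
    have e2 : ∫ x, g x • 𝓕 f x = ∫ x, 𝓕 f x • ψ x := by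
      refine integral_congr_ae (Eventually.of_forall fun x => ?_)
      simp [ψ, mul_comm]
    rw [e1, e2, h1, h2]
    simp only [smul_eq_mul, mul_comm]
  exact (memLp_congr_ae hae).1 (Lp.memLp F)

open scoped FourierTransform in
/-- On the critical line the Mellin integral of `{x}` over `(1, ∞)` is square-integrable: with
`x = e^{-u}` it is the Fourier transform of a function bounded by `e^{u/2}` on `u ≤ 0`. -/
lemma memLp_integral_fract_mul_cpow :
    MemLp (fun t : ℝ => ∫ x in Set.Ioi (1 : ℝ),
      ((Int.fract x : ℝ) : ℂ) * (x : ℂ) ^ (-((1 / 2 + Complex.I * t) + 1))) 2 := by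
  set f : ℝ → ℂ := (Set.Ioi (1 : ℝ)).indicator fun x => ((Int.fract x : ℝ) : ℂ) with hf
  set k : ℝ → ℂ := fun u => Real.exp (1 / 2 * u) • f (Real.exp (-u)) with hk
  have hfm : Measurable f :=
    (Complex.measurable_ofReal.comp measurable_fract).indicator measurableSet_Ioi
  have hkm : Measurable k := by
    exact Measurable.smul (f := fun u : ℝ => Real.exp (1 / 2 * u)) (by fun_prop)
      (hfm.comp (Real.measurable_exp.comp measurable_neg))
  have hkb : ∀ u, ‖k u‖ ≤ (Set.Iic (0 : ℝ)).indicator (fun u => Real.exp (1 / 2 * u)) u := by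
    intro u
    by_cases hu : u ∈ Set.Iic (0 : ℝ)
    · rw [Set.indicator_of_mem hu]
      have : ‖f (Real.exp (-u))‖ ≤ 1 := by
        refine (norm_indicator_le_norm_self _ _).trans ?_
        rw [Complex.norm_real, Real.norm_of_nonneg (Int.fract_nonneg _)]
        exact (Int.fract_lt_one _).le
      simp only [hk, norm_smul, Real.norm_eq_abs, Real.abs_exp]
      exact mul_le_of_le_one_right (Real.exp_pos _).le this
    · have hu' : 0 < u := not_le.1 hu
      have : Real.exp (-u) ∉ Set.Ioi (1 : ℝ) := by simpa using hu'.le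
      rw [Set.indicator_of_notMem hu, hk]
      simp [hf, hu'.le]
  have hk1 : Integrable k :=
    Integrable.mono' ((integrable_indicator_iff measurableSet_Iic).2
      (integrableOn_exp_mul_Iic (by norm_num) 0)) hkm.aestronglyMeasurable
      (Eventually.of_forall hkb)
  have hk2 : MemLp k 2 := by
    rw [memLp_two_iff_integrable_sq_norm hkm.aestronglyMeasurable]
    refine Integrable.mono' ((integrable_indicator_iff measurableSet_Iic).2
      (integrableOn_exp_mul_Iic one_pos 0)) (hkm.norm.pow_const 2).aestronglyMeasurable
      (Eventually.of_forall fun u => ?_)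
    have := hkb u
    rw [Real.norm_of_nonneg (by positivity)]
    refine (pow_le_pow_left₀ (norm_nonneg _) this 2).trans ?_
    by_cases hu : u ∈ Set.Iic (0 : ℝ)
    · simp only [Set.indicator_of_mem hu, ← Real.exp_nat_mul]
      apply le_of_eq
      congr 1
      push_cast
      ring
    · simp [Set.indicator_of_notMem hu]
  have hF := (memLp_fourier_of_integrable_of_memLp hk1 hk2)
  have heq : ∀ t : ℝ, ∫ x in Set.Ioi (1 : ℝ),
      ((Int.fract x : ℝ) : ℂ) * (x : ℂ) ^ (-((1 / 2 + Complex.I * t) + 1))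
        = 𝓕 k (-(2 * Real.pi)⁻¹ * t) := by
    intro t
    have h := mellin_eq_fourier f (s := -(1 / 2 + Complex.I * t))
    have e1 : (-(1 / 2 + Complex.I * (t : ℂ))).re = -(1 / 2) := by simp
    have e2 : (-(1 / 2 + Complex.I * (t : ℂ))).im / (2 * Real.pi) = -(2 * Real.pi)⁻¹ * t := by
      simp
      ring
    rw [e1, e2, neg_neg] at h
    have e3 : ∀ x : ℝ, (x : ℂ) ^ (-(1 / 2 + Complex.I * (t : ℂ)) - 1) • f x =
        (Set.Ioi (1 : ℝ)).indicator (fun x : ℝ =>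
          ((Int.fract x : ℝ) : ℂ) * (x : ℂ) ^ (-((1 / 2 + Complex.I * (t : ℂ)) + 1))) x := by
      intro x
      rw [← neg_add', smul_eq_mul, mul_comm, hf]
      by_cases hx : x ∈ Set.Ioi (1 : ℝ)
      · simp only [Set.indicator_of_mem hx]
      · simp only [Set.indicator_of_notMem hx, zero_mul]
    rw [← h, mellin]
    simp only [e3]
    rw [setIntegral_indicator measurableSet_Ioi, Set.Ioi_inter_Ioi]
    simp
  simp only [heq]
  have hc : -(2 * Real.pi)⁻¹ ≠ 0 := by simp [Real.pi_ne_zero]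
  have hm : AEStronglyMeasurable (fun t : ℝ => 𝓕 k (-(2 * Real.pi)⁻¹ * t)) :=
    (VectorFourier.fourierIntegral_continuous Real.continuous_fourierChar
      (by exact continuous_inner) hk1 |>.comp (continuous_const_mul _)).aestronglyMeasurable
  rw [memLp_two_iff_integrable_sq_norm hm]
  exact ((memLp_two_iff_integrable_sq_norm hF.1).1 hF).comp_mul_left' hc

/-! ### The orthonormal system on the line -/

lemma integrable_cauchyMu_iff {E : Type*} [NormedAddCommGroup E] [NormedSpace ℝ E] {f : ℝ → E} :
    Integrable f cauchyMu ↔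
    Integrable fun t : ℝ => (1 / (2 * Real.pi) * (1 / (1 / 4 + t ^ 2))) • f t := by
  rw [cauchyMu, integrable_withDensity_iff_integrable_smul' (by fun_prop) (by simp)]
  refine integrable_congr (Eventually.of_forall fun t => ?_)
  have : 0 ≤ 1 / (2 * Real.pi) * (1 / (1 / 4 + t ^ 2)) := by positivity
  simp only [ENNReal.toReal_ofReal this]

lemma integral_cauchyMu (f : ℝ → ℂ) : ∫ t, f t ∂cauchyMu =
    ∫ t : ℝ, (1 / (2 * Real.pi) * (1 / (1 / 4 + t ^ 2))) • f t := by
  rw [cauchyMu, integral_withDensity_eq_integral_toReal_smul (by fun_prop) (by simp)]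
  refine integral_congr_ae (Eventually.of_forall fun t => ?_)
  have : 0 ≤ 1 / (2 * Real.pi) * (1 / (1 / 4 + t ^ 2)) := by positivity
  simp only [ENNReal.toReal_ofReal this]

lemma quarter_density_eq (t : ℝ) : 1 / (2 * Real.pi) * (1 / (1 / 4 + t ^ 2)) =
    2 / Real.pi * (1 + (2 * t) ^ 2)⁻¹ := by
  have : 1 + (2 * t) ^ 2 = 4 * (1 / 4 + t ^ 2) := by ring
  have h : (0 : ℝ) < 1 / 4 + t ^ 2 := by positivity
  rw [this]
  field_simp
  norm_num

lemma integrable_density : Integrable fun t : ℝ => 1 / (2 * Real.pi) * (1 / (1 / 4 + t ^ 2)) := by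
  simp only [quarter_density_eq]
  exact (integrable_inv_one_add_sq.comp_mul_left' (by norm_num)).const_mul _

instance isProbabilityMeasure_cauchyMu : IsProbabilityMeasure cauchyMu := by
  constructor
  rw [cauchyMu, withDensity_apply _ MeasurableSet.univ, Measure.restrict_univ,
    ← ofReal_integral_eq_lintegral_ofReal integrable_density
      (Eventually.of_forall fun t => by positivity)]
  simp only [quarter_density_eq]
  rw [integral_const_mul, Measure.integral_comp_mul_left (fun x : ℝ => (1 + x ^ 2)⁻¹),
    integral_univ_inv_one_add_sq]
  have := Real.pi_ne_zero
  norm_num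
  field_simp

/-- The Cayley transform `t ↦ (1/2 - it)/(1/2 + it)` from the real line to the unit circle, which is
`s ↦ (1 - s)/s` on the critical line. -/
noncomputable def cayley (t : ℝ) : ℂ := (1 / 2 - Complex.I * t) / (1 / 2 + Complex.I * t)

lemma half_add_ne_zero (t : ℝ) : 1 / 2 + Complex.I * (t : ℂ) ≠ 0 := by
  intro h
  have := congrArg Complex.re h
  simp at this

lemma half_sub_ne_zero (t : ℝ) : 1 / 2 - Complex.I * (t : ℂ) ≠ 0 := by
  intro h
  have := congrArg Complex.re h
  simp at this

lemma cayley_ne_zero (t : ℝ) : cayley t ≠ 0 := div_ne_zero (half_sub_ne_zero t) (half_add_ne_zero t)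

lemma conj_cayley (t : ℝ) : (starRingEnd ℂ) (cayley t) = (cayley t)⁻¹ := by
  simp [cayley, sub_eq_add_neg, map_ofNat]

lemma norm_cayley (t : ℝ) : ‖cayley t‖ = 1 := by
  have h : cayley t * (starRingEnd ℂ) (cayley t) = 1 := by
    rw [conj_cayley, mul_inv_cancel₀ (cayley_ne_zero t)]
  rw [Complex.mul_conj, Complex.normSq_eq_norm_sq] at h
  have h' : ‖cayley t‖ ^ 2 = 1 := by exact_mod_cast h
  nlinarith [norm_nonneg (cayley t)]

lemma one_add_cayley (t : ℝ) : 1 + cayley t = (1 / 2 + Complex.I * t)⁻¹ := by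
  have := half_add_ne_zero t
  rw [cayley, one_add_div this, ← one_div]
  congr 1
  ring

lemma norm_half_add_sq (t : ℝ) : ‖1 / 2 + Complex.I * (t : ℂ)‖ ^ 2 = 1 / 4 + t ^ 2 := by
  rw [← Complex.normSq_eq_norm_sq, Complex.normSq_apply]
  simp
  ring

lemma half_add_mul_half_sub (t : ℝ) :
    (1 / 2 + Complex.I * (t : ℂ)) * (1 / 2 - Complex.I * t) = ((1 / 4 + t ^ 2 : ℝ) : ℂ) := by
  push_cast
  linear_combination (-(t : ℂ) ^ 2) * Complex.I_sq

lemma hasDerivAt_cayley (t : ℝ) : HasDerivAt cayley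
    (-Complex.I * cayley t * ((1 / (1 / 4 + t ^ 2) : ℝ) : ℂ)) t := by
  have h0 : HasDerivAt (fun z : ℂ => Complex.I * z) Complex.I (t : ℂ) := by
    simpa using (hasDerivAt_id (t : ℂ)).const_mul Complex.I
  have h := ((h0.const_sub (1 / 2)).div (h0.const_add (1 / 2)) (half_add_ne_zero t)).comp_ofReal
  convert! h using 1
  rw [Complex.ofReal_div, ← half_add_mul_half_sub, cayley]
  have h1 := half_add_ne_zero t
  have h2 := half_sub_ne_zero t
  have h3 : (1 / 2 + Complex.I * (t : ℂ)) + (1 / 2 - Complex.I * t) = 1 := by ring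
  generalize 1 / 2 + Complex.I * (t : ℂ) = a at *
  generalize 1 / 2 - Complex.I * (t : ℂ) = b at *
  push_cast
  field_simp
  linear_combination h3

lemma continuous_cayley : Continuous cayley :=
  continuous_iff_continuousAt.2 fun t => (hasDerivAt_cayley t).continuousAt

lemma continuous_cayley_zpow (n : ℤ) : Continuous fun t => cayley t ^ n :=
  continuous_cayley.zpow₀ n fun t => Or.inl (cayley_ne_zero t)

lemma integrable_cayley_zpow (n : ℤ) : Integrable (fun t => cayley t ^ n) cauchyMu :=
  Integrable.of_bound (continuous_cayley_zpow n).aestronglyMeasurable 1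
    (Eventually.of_forall fun t => by simp [norm_cayley])

lemma tendsto_cayley_cocompact : Tendsto cayley (cocompact ℝ) (𝓝 (-1)) := by
  have h1 : Tendsto (fun t : ℝ => 1 / 2 + Complex.I * (t : ℂ)) (cocompact ℝ)
      (Bornology.cobounded ℂ) := by
    rw [← tendsto_norm_atTop_iff_cobounded]
    refine tendsto_atTop_mono (fun t : ℝ => ?_) (tendsto_norm_cocompact_atTop (E := ℝ))
    have := Complex.abs_im_le_norm (1 / 2 + Complex.I * (t : ℂ))
    simpa using this
  have h2 := (tendsto_inv₀_cobounded.comp h1).sub_const 1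
  rw [zero_sub] at h2
  refine h2.congr fun t => ?_
  simp only [Function.comp, ← one_add_cayley]
  ring

/-- The integrand `w^n / (s (1 - s))` is a multiple of the derivative of `w^n`, and `w = cayley t` has
the same limit `-1` at both ends of the line. -/
lemma integral_cayley_zpow {n : ℤ} (hn : n ≠ 0) : ∫ t, cayley t ^ n ∂cauchyMu = 0 := by
  have hn' : (n : ℂ) ≠ 0 := by exact_mod_cast hn
  have hpi : (Real.pi : ℂ) ≠ 0 := by exact_mod_cast Real.pi_ne_zero
  rw [integral_cauchyMu]
  have hderiv : ∀ t : ℝ, HasDerivAt (fun t => Complex.I / (2 * Real.pi * n) * cayley t ^ n)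
      ((1 / (2 * Real.pi) * (1 / (1 / 4 + t ^ 2))) • cayley t ^ n) t := by
    intro t
    have h := (((hasDerivAt_zpow n (cayley t) (Or.inl (cayley_ne_zero t))).comp t
      (hasDerivAt_cayley t))).const_mul (Complex.I / (2 * Real.pi * n))
    convert! h using 1
    rw [Complex.real_smul, zpow_sub_one₀ (cayley_ne_zero t)]
    have := cayley_ne_zero t
    push_cast
    generalize (1 : ℂ) / (1 / 4 + (t : ℂ) ^ 2) = d
    field_simp
    linear_combination d * Complex.I_sq
  have hlim : Tendsto (fun t => Complex.I / (2 * Real.pi * n) * cayley t ^ n) (cocompact ℝ)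
      (𝓝 (Complex.I / (2 * Real.pi * n) * (-1) ^ n)) :=
    (tendsto_cayley_cocompact.zpow₀ n (Or.inl (by norm_num))).const_mul _
  rw [integral_of_hasDerivAt_of_tendsto hderiv
    (integrable_cauchyMu_iff.1 (integrable_cayley_zpow n))
    (hlim.mono_left atBot_le_cocompact) (hlim.mono_left atTop_le_cocompact), sub_self]

lemma integral_cayley_zpow_mul_conj (m n : ℤ) :
    ∫ t, cayley t ^ m * (starRingEnd ℂ) (cayley t ^ n) ∂cauchyMu = if m = n then 1 else 0 := by
  have : ∀ t, cayley t ^ m * (starRingEnd ℂ) (cayley t ^ n) = cayley t ^ (m - n) := by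
    intro t
    rw [map_zpow₀, conj_cayley, inv_zpow, zpow_sub₀ (cayley_ne_zero t), div_eq_mul_inv]
  simp only [this]
  split_ifs with h
  · simp [h]
  · exact integral_cayley_zpow (sub_ne_zero.2 h)

lemma eFun_eq_cayley_pow (n : ℕ) (t : ℝ) : eFun n t = cayley t ^ n := rfl

lemma memLp_cayley_zpow (n : ℤ) : MemLp (fun t => cayley t ^ n) 2 cauchyMu :=
  MemLp.of_bound (continuous_cayley_zpow n).aestronglyMeasurable 1
    (Eventually.of_forall fun t => by simp [norm_cayley])

/-- The `n`-th power of the Cayley transform as an element of `L²(cauchyMu)`. -/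
noncomputable def cayleyLp (n : ℤ) : Lp ℂ 2 cauchyMu := (memLp_cayley_zpow n).toLp _

lemma inner_cayleyLp (n : ℤ) {H : ℝ → ℂ} (hH : MemLp H 2 cauchyMu) :
    inner ℂ (cayleyLp n) (hH.toLp H) = ∫ t, H t * (starRingEnd ℂ) (cayley t ^ n) ∂cauchyMu := by
  rw [L2.inner_def]
  refine integral_congr_ae ?_
  filter_upwards [(memLp_cayley_zpow n).coeFn_toLp, hH.coeFn_toLp] with t h1 h2
  rw [cayleyLp, h1, h2]
  simp

lemma orthonormal_cayleyLp : Orthonormal ℂ cayleyLp := by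
  rw [orthonormal_iff_ite]
  intro i j
  rw [show cayleyLp j = (memLp_cayley_zpow j).toLp _ from rfl,
    inner_cayleyLp i (memLp_cayley_zpow j), integral_cayley_zpow_mul_conj]
  simp only [eq_comm]

/-- Bessel's inequality for the orthonormal system `(cayley t ^ n)`, `n ∈ ℤ`, in qualitative form. -/
lemma summable_sq_norm_integral_mul_conj_cayley {G : ℝ → ℂ} (hG : MemLp G 2 cauchyMu) :
    Summable fun n : ℤ => ‖∫ t, G t * (starRingEnd ℂ) (cayley t ^ n) ∂cauchyMu‖ ^ 2 := by
  simpa only [inner_cayleyLp _ hG] using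
    orthonormal_cayleyLp.inner_products_summable (x := hG.toLp G)

lemma eLpNorm_sum_cayley_pow (s : Finset ℕ) (c : ℕ → ℂ) :
    eLpNorm (fun t => ∑ n ∈ s, c n * cayley t ^ n) 2 cauchyMu =
      ENNReal.ofReal √(∑ n ∈ s, ‖c n‖ ^ 2) := by
  have hv : Orthonormal ℂ fun n : ℕ => cayleyLp n :=
    orthonormal_cayleyLp.comp _ Nat.cast_injective
  set V : Lp ℂ 2 cauchyMu := ∑ n ∈ s, c n • cayleyLp n with hV
  have hnorm : ‖V‖ ^ 2 = ∑ n ∈ s, ‖c n‖ ^ 2 := by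
    have := hv.inner_sum c c s
    have h2 : ((‖V‖ ^ 2 : ℝ) : ℂ) = ((∑ n ∈ s, ‖c n‖ ^ 2 : ℝ) : ℂ) := by
      push_cast
      refine (inner_self_eq_norm_sq_to_K (𝕜 := ℂ) V).symm.trans ?_
      rw [hV, this]
      exact Finset.sum_congr rfl fun n _ => by rw [mul_comm, Complex.mul_conj']
    exact_mod_cast h2
  have hae : V =ᵐ[cauchyMu] fun t => ∑ n ∈ s, c n * cayley t ^ n := by
    have h1 : ∀ n ∈ s, ((c n • cayleyLp n : Lp ℂ 2 cauchyMu) : ℝ → ℂ) =ᵐ[cauchyMu]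
        fun t => c n * cayley t ^ n := by
      intro n _
      filter_upwards [Lp.coeFn_smul (c n) (cayleyLp n), (memLp_cayley_zpow n).coeFn_toLp]
        with t h1 h2
      rw [h1, Pi.smul_apply, cayleyLp, h2, smul_eq_mul, zpow_natCast]
    have h2 : ∀ᵐ t ∂cauchyMu, ∀ n ∈ s, ((c n • cayleyLp n : Lp ℂ 2 cauchyMu) : ℝ → ℂ) t =
        c n * cayley t ^ n := (ae_ball_iff s.countable_toSet).2 h1
    filter_upwards [h2, Lp.coeFn_finsetSum s fun n : ℕ => c n • cayleyLp n] with t h3 h4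
    rw [hV, h4, Finset.sum_apply]
    exact Finset.sum_congr rfl h3
  rw [← eLpNorm_congr_ae hae, ← hnorm, Real.sqrt_sq (norm_nonneg _), Lp.norm_def,
    ENNReal.ofReal_toReal (Lp.eLpNorm_ne_top V)]

/-! ### Fourier coefficients of the boundary values -/

lemma half_add_ne_one (t : ℝ) : 1 / 2 + Complex.I * (t : ℂ) ≠ 1 := by
  intro h
  have := congrArg Complex.re h
  norm_num at this

lemma half_add_re (t : ℝ) : (1 / 2 + Complex.I * (t : ℂ)).re = 1 / 2 := by simp

lemma continuous_riemannZeta₀_line : Continuous fun t : ℝ => riemannZeta₀ (1 / 2 + Complex.I * t) :=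
  differentiable_riemannZeta₀.continuous.comp (by fun_prop)

/-- In `ζ(s) - 1/(s - 1) = 1 - s h(s)` the factor `|s|² = 1/4 + t²` cancels the density of `cauchyMu`,
so the claim is that `h` is square-integrable for Lebesgue measure. -/
lemma memLp_riemannZeta₀_line :
    MemLp (fun t : ℝ => riemannZeta₀ (1 / 2 + Complex.I * t)) 2 cauchyMu := by
  set h : ℝ → ℂ := fun t => ∫ x in Set.Ioi (1 : ℝ),
      ((Int.fract x : ℝ) : ℂ) * (x : ℂ) ^ (-((1 / 2 + Complex.I * t) + 1))
  have heq : ∀ t : ℝ, riemannZeta₀ (1 / 2 + Complex.I * t) = 1 - (1 / 2 + Complex.I * t) * h t :=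
    fun t => riemannZeta₀_eq_one_sub (by rw [half_add_re]; norm_num) (half_add_ne_one t)
  have hm : Continuous fun t : ℝ => (1 / 2 + Complex.I * (t : ℂ)) * h t := by
    have : (fun t : ℝ => (1 / 2 + Complex.I * (t : ℂ)) * h t) =
        fun t : ℝ => 1 - riemannZeta₀ (1 / 2 + Complex.I * t) := by
      funext t
      rw [heq]
      ring
    rw [this]
    exact continuous_const.sub continuous_riemannZeta₀_line
  simp only [heq]
  refine (memLp_const 1).sub ?_
  rw [memLp_two_iff_integrable_sq_norm hm.aestronglyMeasurable, integrable_cauchyMu_iff]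
  have h2 : Integrable fun t => ‖h t‖ ^ 2 :=
    (memLp_two_iff_integrable_sq_norm memLp_integral_fract_mul_cpow.1).1
      memLp_integral_fract_mul_cpow
  refine (h2.const_mul (1 / (2 * Real.pi))).congr (Eventually.of_forall fun t => ?_)
  have : (0 : ℝ) < 1 / 4 + t ^ 2 := by positivity
  simp only [norm_mul, mul_pow, norm_half_add_sq, smul_eq_mul]
  field_simp

/-- Taylor coefficients at `w = 0` of `w ↦ riemannZeta₀ (1 / (1 + w))`. -/
noncomputable def zetaCoeff (n : ℕ) : ℂ := ellCoeff n + if n = 0 then (stieltjesConst 0 : ℂ) else 0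

lemma hasSum_zetaCoeff {w : ℂ} (hw : ‖w‖ < 1) :
    HasSum (fun n => zetaCoeff n * w ^ n) (riemannZeta₀ (1 + w)⁻¹) := by
  have h := (hasSum_ellCoeff hw).add (hasSum_ite_eq 0 (stieltjesConst 0 : ℂ))
  rw [sub_add_cancel] at h
  convert! h using 1
  funext n
  rw [zetaCoeff]
  split_ifs with hn
  · simp [hn]
  · simp

/-- Integration against `conj (cayley t ^ k)` of the power series on the circle of radius `r`. -/
lemma hasSum_integral_riemannZeta₀_mul_conj {r : ℝ} (h0 : 0 ≤ r) (h1 : r < 1) (k : ℤ) :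
    HasSum (fun m : ℕ => zetaCoeff m * (r : ℂ) ^ m * if (m : ℤ) = k then 1 else 0)
      (∫ t, riemannZeta₀ (1 + r * cayley t)⁻¹ * (starRingEnd ℂ) (cayley t ^ k) ∂cauchyMu) := by
  set F : ℕ → ℝ → ℂ := fun m t =>
    zetaCoeff m * (r : ℂ) ^ m * (cayley t ^ (m : ℤ) * (starRingEnd ℂ) (cayley t ^ k)) with hF
  have hnorm : ∀ m t, ‖F m t‖ = ‖zetaCoeff m * (r : ℂ) ^ m‖ := fun m t => by
    simp only [hF]
    rw [norm_mul (_ * _), norm_mul (cayley t ^ (m : ℤ)), RCLike.norm_conj, norm_zpow, norm_zpow,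
      norm_cayley, one_zpow, one_zpow, mul_one, mul_one]
  have hcont : ∀ m, Continuous (F m) := fun m =>
    continuous_const.mul ((continuous_cayley_zpow m).mul
      (Complex.continuous_conj.comp (continuous_cayley_zpow k)))
  have hint : ∀ m, Integrable (F m) cauchyMu := fun m =>
    Integrable.of_bound (hcont m).aestronglyMeasurable _
      (Eventually.of_forall fun t => (hnorm m t).le)
  have hsum : Summable fun m => ∫ t, ‖F m t‖ ∂cauchyMu := by
    simp only [hnorm]
    have hr : ‖(r : ℂ)‖ < 1 := by simpa [abs_of_nonneg h0] using h1
    simpa using (hasSum_zetaCoeff hr).summable.norm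
  have h := hasSum_integral_of_summable_integral_norm hint hsum
  have e1 : ∀ m, ∫ t, F m t ∂cauchyMu =
      zetaCoeff m * (r : ℂ) ^ m * if (m : ℤ) = k then 1 else 0 := fun m => by
    simp only [hF]
    rw [integral_const_mul, integral_cayley_zpow_mul_conj]
  have e2 : ∀ t, ∑' m, F m t =
      riemannZeta₀ (1 + r * cayley t)⁻¹ * (starRingEnd ℂ) (cayley t ^ k) := fun t => by
    have hs := (hasSum_zetaCoeff (w := (r : ℂ) * cayley t)
      (by simpa [norm_cayley, abs_of_nonneg h0] using h1)).mul_right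
        ((starRingEnd ℂ) (cayley t ^ k))
    rw [← hs.tsum_eq]
    refine tsum_congr fun m => ?_
    simp only [hF, zpow_natCast, mul_pow]
    ring
  simpa only [e1, e2] using h

lemma half_le_re_inv_one_add {z : ℂ} (hz : ‖z‖ ≤ 1) (hz1 : 1 + z ≠ 0) :
    1 / 2 ≤ ((1 + z)⁻¹).re := by
  have h1 : 0 < Complex.normSq (1 + z) := Complex.normSq_pos.2 hz1
  have h2 : Complex.normSq z ≤ 1 := by
    rw [Complex.normSq_eq_norm_sq]
    nlinarith [norm_nonneg z]
  rw [Complex.inv_re, le_div_iff₀ h1]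
  rw [Complex.normSq_apply] at h2 ⊢
  simp only [Complex.add_re, Complex.add_im, Complex.one_re, Complex.one_im]
  nlinarith

lemma one_add_mul_cayley_ne_zero {r : ℝ} (h0 : 0 ≤ r) (h1 : r < 1) (t : ℝ) :
    1 + (r : ℂ) * cayley t ≠ 0 := by
  intro h
  have := congrArg norm (eq_neg_of_add_eq_zero_right h)
  simp [norm_cayley, abs_of_nonneg h0] at this
  linarith

/-- The point `1 / (1 + r w)` is at most twice as far from the origin as the boundary point
`s = 1 / (1 + w)`. This provides the dominating function for the limit `r → 1`. -/
lemma norm_inv_one_add_mul_cayley_le {r : ℝ} (h0 : 0 ≤ r) (h1 : r < 1) (t : ℝ) :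
    ‖(1 + (r : ℂ) * cayley t)⁻¹‖ ≤ 2 * ‖1 / 2 + Complex.I * (t : ℂ)‖ := by
  have hpos : 0 < ‖1 + (r : ℂ) * cayley t‖ := norm_pos_iff.2 (one_add_mul_cayley_ne_zero h0 h1 t)
  have hs : 0 < ‖1 / 2 + Complex.I * (t : ℂ)‖ := norm_pos_iff.2 (half_add_ne_zero t)
  have ha : 1 - r ≤ ‖1 + (r : ℂ) * cayley t‖ := by
    have := norm_sub_norm_le (1 : ℂ) (-((r : ℂ) * cayley t))
    simpa [norm_cayley, abs_of_nonneg h0] using this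
  have hb : ‖1 / 2 + Complex.I * (t : ℂ)‖⁻¹ ≤ 2 * ‖1 + (r : ℂ) * cayley t‖ := by
    rw [← norm_inv, ← one_add_cayley]
    have : 1 + cayley t = (1 + (r : ℂ) * cayley t) + ((1 - r : ℝ) : ℂ) * cayley t := by
      push_cast; ring
    rw [this]
    refine (norm_add_le _ _).trans ?_
    rw [norm_mul, norm_cayley, Complex.norm_real, Real.norm_of_nonneg (by linarith)]
    linarith
  rw [norm_inv, inv_le_iff_one_le_mul₀ hpos]
  rw [inv_le_iff_one_le_mul₀ hs] at hb
  linarith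

lemma integrable_sqrt_norm_half_add :
    Integrable (fun t : ℝ => √‖1 / 2 + Complex.I * (t : ℂ)‖) cauchyMu := by
  rw [integrable_cauchyMu_iff]
  have h := (integrable_rpow_neg_one_add_norm_sq (E := ℝ) (μ := volume) (r := 3 / 2)
    (by norm_num)).comp_mul_left' (two_ne_zero)
  refine (h.const_mul (4 ^ (3 / 4 : ℝ) * (1 / (2 * Real.pi)))).congr
    (Eventually.of_forall fun t => ?_)
  have hs : 0 < ‖1 / 2 + Complex.I * (t : ℂ)‖ := norm_pos_iff.2 (half_add_ne_zero t)
  have e : (1 : ℝ) + ‖2 * t‖ ^ 2 = 4 * ‖1 / 2 + Complex.I * (t : ℂ)‖ ^ 2 := by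
    rw [norm_half_add_sq, Real.norm_eq_abs, sq_abs]; ring
  simp only [e, ← norm_half_add_sq, smul_eq_mul]
  rw [Real.mul_rpow (by norm_num) (by positivity), ← Real.rpow_natCast, ← Real.rpow_mul hs.le,
    Real.sqrt_eq_rpow, one_div (_ ^ ((2 : ℕ) : ℝ)), ← Real.rpow_neg hs.le]
  have h1 : (4 : ℝ) ^ (3 / 4 : ℝ) * 4 ^ (-(3 / 2) / 2 : ℝ) = 1 := by
    rw [← Real.rpow_add (by norm_num)]
    norm_num
  have h2 : ‖1 / 2 + Complex.I * (t : ℂ)‖ ^ (-((2 : ℕ) : ℝ)) *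
      ‖1 / 2 + Complex.I * (t : ℂ)‖ ^ (1 / 2 : ℝ) =
      ‖1 / 2 + Complex.I * (t : ℂ)‖ ^ (((2 : ℕ) : ℝ) * (-(3 / 2) / 2)) := by
    rw [← Real.rpow_add hs]
    norm_num
  rw [mul_assoc (1 / (2 * Real.pi)), h2]
  linear_combination (1 / (2 * Real.pi) *
    ‖1 / 2 + Complex.I * (t : ℂ)‖ ^ (((2 : ℕ) : ℝ) * (-(3 / 2) / 2))) * h1

lemma tendsto_integral_riemannZeta₀_mul_conj (k : ℤ) :
    Tendsto (fun r : ℝ => ∫ t, riemannZeta₀ (1 + r * cayley t)⁻¹ *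
      (starRingEnd ℂ) (cayley t ^ k) ∂cauchyMu) (𝓝[<] 1)
      (𝓝 (∫ t, riemannZeta₀ (1 / 2 + Complex.I * t) *
        (starRingEnd ℂ) (cayley t ^ k) ∂cauchyMu)) := by
  obtain ⟨C, hC0, hC⟩ := exists_norm_riemannZeta₀_le
  have hr : ∀ᶠ r : ℝ in 𝓝[<] 1, 0 ≤ r ∧ r < 1 := by
    filter_upwards [Ioo_mem_nhdsLT (show (0 : ℝ) < 1 by norm_num)] with r hr using ⟨hr.1.le, hr.2⟩
  refine tendsto_integral_filter_of_dominated_convergence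
    (fun t => C * √2 * √‖1 / 2 + Complex.I * (t : ℂ)‖) ?_ ?_
    (integrable_sqrt_norm_half_add.const_mul _) ?_
  · filter_upwards [hr] with r hr
    refine Continuous.aestronglyMeasurable (Continuous.mul ?_
      (Complex.continuous_conj.comp (continuous_cayley_zpow k)))
    exact differentiable_riemannZeta₀.continuous.comp
      ((continuous_const.add (continuous_const.mul continuous_cayley)).inv₀
        fun t => one_add_mul_cayley_ne_zero hr.1 hr.2 t)
  · filter_upwards [hr] with r hr
    refine Eventually.of_forall fun t => ?_
    have hz := one_add_mul_cayley_ne_zero hr.1 hr.2 t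
    rw [norm_mul, RCLike.norm_conj, norm_zpow, norm_cayley, one_zpow, mul_one, mul_assoc,
      ← Real.sqrt_mul (by norm_num)]
    refine (hC _ (half_le_re_inv_one_add ?_ hz)).trans ?_
    · simpa [norm_cayley, abs_of_nonneg hr.1] using hr.2.le
    · gcongr
      exact norm_inv_one_add_mul_cayley_le hr.1 hr.2 t
  · refine Eventually.of_forall fun t => Tendsto.mul_const _ ?_
    have h1 : 1 / 2 + Complex.I * (t : ℂ) = (1 + ((1 : ℝ) : ℂ) * cayley t)⁻¹ := by
      rw [Complex.ofReal_one, one_mul, one_add_cayley, inv_inv]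
    have hne : 1 + ((1 : ℝ) : ℂ) * cayley t ≠ 0 := by
      rw [Complex.ofReal_one, one_mul, one_add_cayley]
      exact inv_ne_zero (half_add_ne_zero t)
    rw [h1]
    have hc : ContinuousAt (fun r : ℝ => riemannZeta₀ (1 + (r : ℂ) * cayley t)⁻¹) 1 :=
      ContinuousAt.comp (g := riemannZeta₀) differentiable_riemannZeta₀.continuous.continuousAt
        (ContinuousAt.inv₀ (by fun_prop) hne)
    exact hc.tendsto.mono_left nhdsWithin_le_nhds

/-- The boundary function has the Taylor coefficients as Fourier coefficients of index `n ≥ 0`. -/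
lemma integral_riemannZeta₀_mul_conj_natCast (n : ℕ) :
    ∫ t, riemannZeta₀ (1 / 2 + Complex.I * t) * (starRingEnd ℂ) (cayley t ^ (n : ℤ)) ∂cauchyMu
      = zetaCoeff n := by
  refine tendsto_nhds_unique (tendsto_integral_riemannZeta₀_mul_conj n) ?_
  have h : Tendsto (fun r : ℝ => zetaCoeff n * (r : ℂ) ^ n) (𝓝[<] 1) (𝓝 (zetaCoeff n)) := by
    have hc : Continuous fun r : ℝ => zetaCoeff n * (r : ℂ) ^ n := by fun_prop
    simpa using (hc.tendsto 1).mono_left nhdsWithin_le_nhds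
  refine h.congr' ?_
  filter_upwards [Ioo_mem_nhdsLT (show (0 : ℝ) < 1 by norm_num)] with r hr
  refine HasSum.unique ?_ (hasSum_integral_riemannZeta₀_mul_conj hr.1.le hr.2 n)
  convert! hasSum_ite_eq n (zetaCoeff n * (r : ℂ) ^ n) using 2 with m
  by_cases hm : m = n <;> simp [hm]

lemma integral_riemannZeta₀_mul_conj_of_neg {k : ℤ} (hk : k < 0) :
    ∫ t, riemannZeta₀ (1 / 2 + Complex.I * t) * (starRingEnd ℂ) (cayley t ^ k) ∂cauchyMu = 0 := by
  refine tendsto_nhds_unique (tendsto_integral_riemannZeta₀_mul_conj k)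
    (tendsto_const_nhds.congr' ?_)
  filter_upwards [Ioo_mem_nhdsLT (show (0 : ℝ) < 1 by norm_num)] with r hr
  refine HasSum.unique ?_ (hasSum_integral_riemannZeta₀_mul_conj hr.1.le hr.2 k)
  convert! hasSum_zero using 2 with m
  have : (m : ℤ) ≠ k := by omega
  simp [this]

/-! ### Convergence of the Fourier series on the boundary -/

/-- The difference quotient `(G(w) - G(w₀)) / (w - w₀)` on the unit circle, where
`G(w) = riemannZeta₀ (1 / (1 + w))`, `w = cayley t` and `w₀ = cayley t₀`, written so as to be
continuous at `t₀`. -/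
noncomputable def cayleyQuotient (t₀ t : ℝ) : ℂ :=
  -((1 / 2 + Complex.I * t) * (1 / 2 + Complex.I * t₀)) *
    dslope riemannZeta₀ (1 / 2 + Complex.I * t₀) (1 / 2 + Complex.I * t)

lemma cayley_sub_mul_cayleyQuotient (t₀ t : ℝ) :
    (cayley t - cayley t₀) * cayleyQuotient t₀ t =
      riemannZeta₀ (1 / 2 + Complex.I * t) - riemannZeta₀ (1 / 2 + Complex.I * t₀) := by
  have h := sub_smul_dslope riemannZeta₀ (1 / 2 + Complex.I * (t₀ : ℂ)) (1 / 2 + Complex.I * t)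
  have e : cayley t - cayley t₀ =
      (1 / 2 + Complex.I * (t : ℂ))⁻¹ - (1 / 2 + Complex.I * (t₀ : ℂ))⁻¹ := by
    rw [← one_add_cayley, ← one_add_cayley]
    ring
  have h1 := half_add_ne_zero t
  have h2 := half_add_ne_zero t₀
  rw [e, cayleyQuotient, ← h, smul_eq_mul]
  generalize 1 / 2 + Complex.I * (t : ℂ) = a at *
  generalize 1 / 2 + Complex.I * (t₀ : ℂ) = b at *
  field_simp
  ring

lemma continuous_cayleyQuotient (t₀ : ℝ) : Continuous (cayleyQuotient t₀) := by
  have hd : Continuous (dslope riemannZeta₀ (1 / 2 + Complex.I * (t₀ : ℂ))) := by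
    rw [← continuousOn_univ, continuousOn_dslope univ_mem]
    exact ⟨differentiable_riemannZeta₀.continuous.continuousOn, differentiable_riemannZeta₀ _⟩
  unfold cayleyQuotient
  exact Continuous.mul (by fun_prop) (hd.comp (by fun_prop))

lemma norm_cayleyQuotient_le {t₀ t : ℝ} (h : 1 ≤ |t - t₀|) :
    ‖cayleyQuotient t₀ t‖ ≤ (‖1 / 2 + Complex.I * (t₀ : ℂ)‖ + 1) * ‖1 / 2 + Complex.I * (t₀ : ℂ)‖ *
      (‖riemannZeta₀ (1 / 2 + Complex.I * t)‖ + ‖riemannZeta₀ (1 / 2 + Complex.I * t₀)‖) := by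
  have hpos : 0 < |t - t₀| := by linarith
  have e : (1 / 2 + Complex.I * (t : ℂ)) - (1 / 2 + Complex.I * t₀)
      = Complex.I * ((t - t₀ : ℝ) : ℂ) := by push_cast; ring
  have hn : ‖(1 / 2 + Complex.I * (t : ℂ)) - (1 / 2 + Complex.I * t₀)‖ = |t - t₀| := by
    rw [e, norm_mul, Complex.norm_I, one_mul, Complex.norm_real, Real.norm_eq_abs]
  have h1 : ‖1 / 2 + Complex.I * (t : ℂ)‖ ≤ (‖1 / 2 + Complex.I * (t₀ : ℂ)‖ + 1) * |t - t₀| := by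
    have := norm_le_norm_add_norm_sub (1 / 2 + Complex.I * (t₀ : ℂ)) (1 / 2 + Complex.I * (t : ℂ))
    rw [norm_sub_rev, hn] at this
    nlinarith [norm_nonneg (1 / 2 + Complex.I * (t₀ : ℂ))]
  have h2 : |t - t₀| * ‖dslope riemannZeta₀ (1 / 2 + Complex.I * t₀) (1 / 2 + Complex.I * t)‖ ≤
      ‖riemannZeta₀ (1 / 2 + Complex.I * t)‖ + ‖riemannZeta₀ (1 / 2 + Complex.I * t₀)‖ := by
    rw [← hn, ← norm_mul, ← smul_eq_mul, sub_smul_dslope]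
    exact norm_sub_le _ _
  rw [cayleyQuotient, norm_mul, norm_neg, norm_mul]
  calc _ ≤ ((‖1 / 2 + Complex.I * (t₀ : ℂ)‖ + 1) * |t - t₀|) * ‖1 / 2 + Complex.I * (t₀ : ℂ)‖ *
        ‖dslope riemannZeta₀ (1 / 2 + Complex.I * t₀) (1 / 2 + Complex.I * t)‖ := by gcongr
    _ = (‖1 / 2 + Complex.I * (t₀ : ℂ)‖ + 1) * ‖1 / 2 + Complex.I * (t₀ : ℂ)‖ *
        (|t - t₀| * ‖dslope riemannZeta₀ (1 / 2 + Complex.I * t₀) (1 / 2 + Complex.I * t)‖) := by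
      ring
    _ ≤ _ := by gcongr

lemma memLp_cayleyQuotient (t₀ : ℝ) : MemLp (cayleyQuotient t₀) 2 cauchyMu := by
  obtain ⟨K, hK⟩ := (isCompact_closedBall t₀ 1).exists_bound_of_continuousOn
    (continuous_cayleyQuotient t₀).continuousOn
  have hK0 : 0 ≤ K := (norm_nonneg _).trans (hK t₀ (by simp))
  set A := (‖1 / 2 + Complex.I * (t₀ : ℂ)‖ + 1) * ‖1 / 2 + Complex.I * (t₀ : ℂ)‖ with hA
  have hA0 : 0 ≤ A := by positivity
  have hdom : MemLp (fun t : ℝ => K + A * (‖riemannZeta₀ (1 / 2 + Complex.I * t)‖ +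
      ‖riemannZeta₀ (1 / 2 + Complex.I * t₀)‖)) 2 cauchyMu :=
    (memLp_const K).add ((memLp_riemannZeta₀_line.norm.add (memLp_const _)).const_mul A)
  refine hdom.mono' (continuous_cayleyQuotient t₀).aestronglyMeasurable
    (Eventually.of_forall fun t => ?_)
  rcases le_total 1 |t - t₀| with h | h
  · have := norm_cayleyQuotient_le h
    linarith
  · have h1 := hK t (by simpa [Real.dist_eq] using h)
    have : 0 ≤ A * (‖riemannZeta₀ (1 / 2 + Complex.I * t)‖ +
      ‖riemannZeta₀ (1 / 2 + Complex.I * t₀)‖) := by positivity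
    linarith

lemma integrable_mul_conj_cayley_zpow {G : ℝ → ℂ} (hG : MemLp G 2 cauchyMu) (k : ℤ) :
    Integrable (fun t => G t * (starRingEnd ℂ) (cayley t ^ k)) cauchyMu := by
  refine (hG.integrable (by norm_num)).mul_bdd (c := 1)
    (Complex.continuous_conj.comp (continuous_cayley_zpow k)).aestronglyMeasurable
    (Eventually.of_forall fun t => ?_)
  simp [norm_cayley]

/-- The Fourier coefficient of `cayleyQuotient t₀` of index `k` for the system `cayley t ^ k`. -/
noncomputable def quotientCoeff (t₀ : ℝ) (k : ℤ) : ℂ :=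
  ∫ t, cayleyQuotient t₀ t * (starRingEnd ℂ) (cayley t ^ k) ∂cauchyMu

/-- Multiplying `cayleyQuotient t₀` by `w - w₀` gives `G(w) - G(w₀)`; this is the resulting relation
between the Fourier coefficients. -/
lemma quotientCoeff_sub_one_sub (t₀ : ℝ) (k : ℤ) :
    quotientCoeff t₀ (k - 1) - cayley t₀ * quotientCoeff t₀ k =
      ∫ t, riemannZeta₀ (1 / 2 + Complex.I * t) * (starRingEnd ℂ) (cayley t ^ k) ∂cauchyMu -
        if k = 0 then riemannZeta₀ (1 / 2 + Complex.I * t₀) else 0 := by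
  have hQ := fun k => integrable_mul_conj_cayley_zpow (memLp_cayleyQuotient t₀) k
  have h1 : (if k = 0 then riemannZeta₀ (1 / 2 + Complex.I * t₀) else 0) =
      ∫ t, riemannZeta₀ (1 / 2 + Complex.I * t₀) * (starRingEnd ℂ) (cayley t ^ k) ∂cauchyMu := by
    have := integral_cayley_zpow_mul_conj 0 k
    simp only [zpow_zero, one_mul] at this
    rw [integral_const_mul, this]
    by_cases hk : k = 0
    · simp [hk]
    · simp [hk, Ne.symm hk]
  rw [quotientCoeff, quotientCoeff, h1, ← integral_const_mul,
    ← integral_sub (hQ _) ((hQ _).const_mul _),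
    ← integral_sub (integrable_mul_conj_cayley_zpow memLp_riemannZeta₀_line k)
      (integrable_mul_conj_cayley_zpow (memLp_const _) k)]
  refine integral_congr_ae (Eventually.of_forall fun t => ?_)
  have hz : (starRingEnd ℂ) (cayley t ^ (k - 1)) = cayley t * (starRingEnd ℂ) (cayley t ^ k) := by
    simp only [map_zpow₀, conj_cayley]
    rw [zpow_sub_one₀ (inv_ne_zero (cayley_ne_zero t)), inv_inv, mul_comm]
  simp only [hz, ← sub_mul, ← cayley_sub_mul_cayleyQuotient]
  ring

lemma tendsto_quotientCoeff (t₀ : ℝ) : Tendsto (quotientCoeff t₀) cofinite (𝓝 0) := by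
  have h := (summable_sq_norm_integral_mul_conj_cayley
    (memLp_cayleyQuotient t₀)).tendsto_cofinite_zero.sqrt
  rw [tendsto_zero_iff_norm_tendsto_zero]
  simpa [Real.sqrt_sq, quotientCoeff] using h

/-- The coefficients of negative index all have the same absolute value, and they tend to `0`. -/
lemma quotientCoeff_neg_one (t₀ : ℝ) : quotientCoeff t₀ (-1) = 0 := by
  have hconst : ∀ j : ℕ, ‖quotientCoeff t₀ (-1 - j)‖ = ‖quotientCoeff t₀ (-1)‖ := by
    intro j
    induction j with
    | zero => simp
    | succ j ih =>
      have h := quotientCoeff_sub_one_sub t₀ (-1 - j)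
      rw [integral_riemannZeta₀_mul_conj_of_neg (by omega), if_neg (by omega), sub_zero,
        sub_eq_zero] at h
      rw [← ih, show (-1 - ((j + 1 : ℕ) : ℤ)) = -1 - j - 1 by push_cast; ring, h, norm_mul,
        norm_cayley, one_mul]
  have hinj : Function.Injective fun j : ℕ => (-1 - j : ℤ) := fun a b h => by
    simp only at h
    omega
  have h := ((tendsto_quotientCoeff t₀).comp hinj.tendsto_cofinite).norm
  simp only [Function.comp_def, hconst, norm_zero] at h
  exact norm_eq_zero.1 (tendsto_nhds_unique tendsto_const_nhds h)

/-- The recursion `quotientCoeff_sub_one_sub` telescopes. -/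
lemma sum_zetaCoeff_sub (t₀ : ℝ) (N : ℕ) :
    ∑ n ∈ Finset.range (N + 1), zetaCoeff n * cayley t₀ ^ n -
      riemannZeta₀ (1 / 2 + Complex.I * t₀) = -(cayley t₀ ^ (N + 1) * quotientCoeff t₀ N) := by
  induction N with
  | zero =>
    have h := quotientCoeff_sub_one_sub t₀ (0 : ℕ)
    rw [integral_riemannZeta₀_mul_conj_natCast, Nat.cast_zero, zero_sub, quotientCoeff_neg_one] at h
    simp only [if_true] at h
    rw [zero_add, Finset.sum_range_one, pow_zero, pow_one, Nat.cast_zero]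
    linear_combination -h
  | succ N ih =>
    have h := quotientCoeff_sub_one_sub t₀ (N + 1 : ℕ)
    rw [integral_riemannZeta₀_mul_conj_natCast, if_neg (by omega), sub_zero,
      show (((N + 1 : ℕ) : ℤ) - 1) = N by push_cast; ring] at h
    rw [Finset.sum_range_succ]
    linear_combination ih - cayley t₀ ^ (N + 1) * h

lemma tendsto_sum_zetaCoeff (t : ℝ) :
    Tendsto (fun N => ∑ n ∈ Finset.range (N + 1), zetaCoeff n * cayley t ^ n) atTop
      (𝓝 (riemannZeta₀ (1 / 2 + Complex.I * t))) := by
  rw [tendsto_iff_norm_sub_tendsto_zero]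
  simp only [sum_zetaCoeff_sub, norm_neg, norm_mul, norm_pow, norm_cayley, one_pow, one_mul]
  have h := ((tendsto_quotientCoeff t).comp
    (Nat.cast_injective (R := ℤ)).tendsto_cofinite).norm
  simpa [Nat.cofinite_eq_atTop] using h

lemma summable_sq_norm_zetaCoeff : Summable fun n => ‖zetaCoeff n‖ ^ 2 := by
  have h := (summable_sq_norm_integral_mul_conj_cayley memLp_riemannZeta₀_line).comp_injective
    (Nat.cast_injective (R := ℤ))
  simpa only [Function.comp_def, integral_riemannZeta₀_mul_conj_natCast] using h

/-- By Fatou's lemma, pointwise convergence and square summability of the coefficients give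
convergence in `L²`. -/
lemma eLpNorm_riemannZeta₀_sub_sum_le (N : ℕ) :
    eLpNorm (fun t : ℝ => riemannZeta₀ (1 / 2 + Complex.I * t) -
      ∑ n ∈ Finset.range (N + 1), zetaCoeff n * cayley t ^ n) 2 cauchyMu ≤
      ENNReal.ofReal √(∑' n, ‖zetaCoeff n‖ ^ 2 -
        ∑ n ∈ Finset.range (N + 1), ‖zetaCoeff n‖ ^ 2) := by
  set S : ℕ → ℝ → ℂ := fun N t => ∑ n ∈ Finset.range (N + 1), zetaCoeff n * cayley t ^ n with hS
  have hcont : ∀ M, Continuous (S M) := fun M =>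
    continuous_finsetSum _ fun n _ => continuous_const.mul (continuous_cayley.pow n)
  refine (Lp.eLpNorm_lim_le_liminf_eLpNorm (f := fun M t => S M t - S N t)
    (fun M => ((hcont M).sub (hcont N)).aestronglyMeasurable) _
    (Eventually.of_forall fun t => (tendsto_sum_zetaCoeff t).sub_const _)).trans ?_
  refine liminf_le_of_frequently_le' (Eventually.frequently ?_)
  filter_upwards [eventually_ge_atTop N] with M hM
  have hdiff : ∀ f : ℕ → ℂ, ∑ n ∈ Finset.range (M + 1), f n - ∑ n ∈ Finset.range (N + 1), f n =
      ∑ n ∈ Finset.Ico (N + 1) (M + 1), f n := fun f =>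
    (Finset.sum_Ico_eq_sub f (by omega)).symm
  simp only [hS, hdiff, eLpNorm_sum_cayley_pow]
  refine ENNReal.ofReal_le_ofReal (Real.sqrt_le_sqrt ?_)
  rw [Finset.sum_Ico_eq_sub _ (by omega : N + 1 ≤ M + 1)]
  gcongr
  exact summable_sq_norm_zetaCoeff.sum_le_tsum _ fun n _ => by positivity

lemma tendsto_eLpNorm_riemannZeta₀_sub_sum :
    Tendsto (fun N => eLpNorm (fun t : ℝ => riemannZeta₀ (1 / 2 + Complex.I * t) -
      ∑ n ∈ Finset.range (N + 1), zetaCoeff n * cayley t ^ n) 2 cauchyMu) atTop (𝓝 0) := by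
  have h1 : Tendsto (fun N => ∑' n, ‖zetaCoeff n‖ ^ 2 -
      ∑ n ∈ Finset.range (N + 1), ‖zetaCoeff n‖ ^ 2) atTop (𝓝 0) := by
    have h := (summable_sq_norm_zetaCoeff.hasSum.tendsto_sum_nat.comp
      (tendsto_add_atTop_nat 1)).const_sub (∑' n, ‖zetaCoeff n‖ ^ 2)
    rwa [sub_self] at h
  have h2 := ENNReal.tendsto_ofReal h1.sqrt
  rw [Real.sqrt_zero, ENNReal.ofReal_zero] at h2
  exact tendsto_of_tendsto_of_tendsto_of_le_of_le tendsto_const_nhds h2 (fun _ => bot_le)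
    eLpNorm_riemannZeta₀_sub_sum_le

lemma half_add_sub_one_inv (t : ℝ) :
    ((1 / 2 + Complex.I * (t : ℂ)) - 1)⁻¹ = -(1 / (1 / 2 - Complex.I * t)) := by
  rw [show (1 / 2 + Complex.I * (t : ℂ)) - 1 = -(1 / 2 - Complex.I * t) by ring, inv_neg,
    inv_eq_one_div]

lemma zetaLine_eq (t : ℝ) : zetaLine t =
    riemannZeta₀ (1 / 2 + Complex.I * t) - 1 / (1 / 2 - Complex.I * t) := by
  rw [zetaLine, riemannZeta_eq_inv_sub_add (half_add_ne_one t), half_add_sub_one_inv]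
  ring

lemma zetaPartial_eq (N : ℕ) (t : ℝ) : zetaPartial N t =
    ∑ n ∈ Finset.range (N + 1), zetaCoeff n * cayley t ^ n - 1 / (1 / 2 - Complex.I * t) := by
  rw [zetaPartial, sum_Icc_one_eq_sum_range, Finset.sum_range_succ']
  simp [zetaCoeff, eFun_eq_cayley_pow, ellCoeff]
  ring

/-- On the unit circle `1 / s = 1 + w`, and conjugation turns this into `1 / (1 - s) = 1 + w⁻¹`. -/
lemma one_div_half_sub (t : ℝ) :
    1 / (1 / 2 - Complex.I * (t : ℂ)) = 1 + (starRingEnd ℂ) (cayley t) := by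
  have h := congrArg (starRingEnd ℂ) (one_add_cayley t)
  rw [map_add, map_one] at h
  rw [h]
  simp [sub_eq_add_neg, map_ofNat]

lemma memLp_one_div_half_sub :
    MemLp (fun t : ℝ => 1 / (1 / 2 - Complex.I * (t : ℂ))) 2 cauchyMu := by
  simp only [one_div_half_sub]
  refine MemLp.of_bound (C := 2) (continuous_const.add
    (Complex.continuous_conj.comp continuous_cayley)).aestronglyMeasurable
    (Eventually.of_forall fun t => (norm_add_le _ _).trans ?_)
  rw [RCLike.norm_conj, norm_cayley, norm_one]
  norm_num

lemma memLp_zetaLine : MemLp zetaLine 2 cauchyMu := by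
  rw [show zetaLine = _ from funext zetaLine_eq]
  exact memLp_riemannZeta₀_line.sub memLp_one_div_half_sub

lemma integral_zetaLine_mul_conj_eFun {n : ℕ} (hn : 1 ≤ n) :
    ∫ t, zetaLine t * (starRingEnd ℂ) (eFun n t) ∂cauchyMu = (ellCoeff n : ℂ) := by
  have h1 : ∫ t : ℝ, 1 / (1 / 2 - Complex.I * (t : ℂ)) *
      (starRingEnd ℂ) (cayley t ^ (n : ℤ)) ∂cauchyMu
      = 0 := by
    have e : ∀ t : ℝ, 1 / (1 / 2 - Complex.I * (t : ℂ)) * (starRingEnd ℂ) (cayley t ^ (n : ℤ)) =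
        cayley t ^ (-n : ℤ) + cayley t ^ (-n - 1 : ℤ) := by
      intro t
      rw [one_div_half_sub, map_zpow₀, conj_cayley, zpow_sub_one₀ (cayley_ne_zero t), inv_zpow,
        zpow_neg]
      ring
    simp only [e]
    rw [integral_add (integrable_cayley_zpow _) (integrable_cayley_zpow _),
      integral_cayley_zpow (by omega), integral_cayley_zpow (by omega), add_zero]
  have h2 := integral_riemannZeta₀_mul_conj_natCast n
  rw [zetaCoeff, if_neg (by omega), add_zero] at h2
  rw [← h2, ← sub_zero (∫ t : ℝ, riemannZeta₀ _ * _ ∂cauchyMu), ← h1,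
    ← integral_sub (integrable_mul_conj_cayley_zpow memLp_riemannZeta₀_line n)
      (integrable_mul_conj_cayley_zpow memLp_one_div_half_sub n)]
  refine integral_congr_ae (Eventually.of_forall fun t => ?_)
  simp only [zetaLine_eq, eFun_eq_cayley_pow, zpow_natCast, sub_mul]

theorem theorem1 :
    -- the limits defining the Stieltjes constants exist
    (∀ k : ℕ, Tendsto (stieltjesApprox k) atTop (𝓝 (stieltjesConst k))) ∧
    -- pointwise (possibly conditional) convergence at every real point
    (∀ t : ℝ, Tendsto (fun N : ℕ => zetaPartial N t) atTop (𝓝 (zetaLine t))) ∧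
    -- convergence in the space of square-integrable functions
    MemLp zetaLine 2 cauchyMu ∧
    Tendsto (fun N : ℕ => eLpNorm (fun t => zetaLine t - zetaPartial N t) 2 cauchyMu)
      atTop (𝓝 0) ∧
    -- the coefficients are the Fourier coefficients
    (∀ n : ℕ, 1 ≤ n →
      ∫ t, zetaLine t * (starRingEnd ℂ) (eFun n t) ∂cauchyMu = (ellCoeff n : ℂ)) ∧
    -- and they are minus the residues at `s = 1` of `ζ(s) s^(n-1) / (1-s)^(n+1)`
    (∀ n : ℕ, 1 ≤ n → ∀ r : ℝ, 0 < r → r < 1 →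
      (2 * Real.pi * Complex.I)⁻¹ *
        (∮ s in C(1, r), riemannZeta s * s ^ (n - 1) / (1 - s) ^ (n + 1))
          = -(ellCoeff n : ℂ)) := by
  refine ⟨tendsto_stieltjesApprox, fun t => ?_, memLp_zetaLine, ?_,
    fun n hn => integral_zetaLine_mul_conj_eFun hn,
    fun n hn r hr _ => circleIntegral_riemannZeta hn hr⟩
  · simp only [zetaLine_eq, zetaPartial_eq]
    exact (tendsto_sum_zetaCoeff t).sub_const _
  · simp only [zetaLine_eq, zetaPartial_eq, sub_sub_sub_cancel_right]
    exact tendsto_eLpNorm_riemannZeta₀_sub_sum
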